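/- **Setting.** Let $n\ge 1$ be an integer, $\sigma\ge 0$, and let $x=(x_t)_{t\in\mathbb Z}$ be a complex sequence observed as $y_\tau=x_\tau+\sigma\zeta_\tau$, $-n\le\tau\le n$, where $\zeta_{-n},\dots,\zeta_n$ are i.i.d. standard complex Gaussian variables (real and imaginary parts independent $\mathcal N(0,1)$). For a filter $\varphi=(\varphi_0,\dots,\varphi_n)\in\mathbb C^{n+1}$ put $[\varphi*y]_t=\sum_{\tau=0}^n\varphi_\tau y_{t-\tau}$, $\|z\|_{n,2}=(\sum_{t=0}^n|z_t|^2)^{1/2}$ and $\|\varphi\|^*_{n,1}=\sum_{k=0}^n|(F_n\varphi)_k|$, where $(F_n\varphi)_k=(n+1)^{-1/2}\sum_{t=0}^n\varphi_t e^{2\pi i kt/(n+1)}$. For $\lambda\ge 0$ the penalized recovery is $\widehat x_{\rm pen}=\widehat\varphi*y$, where $$\widehat\varphi\in\mathop{\rm Argmin}_{\varphi\in\mathbb C^{n+1}}\Big\{\|y-\varphi*y\|_{n,2}^2+\lambda\sqrt{n+1}\,\|\varphi\|^*_{n,1}\Big\},\qquad \widehat\varrho:=\sqrt{n+1}\,\|\widehat\varphi\|^*_{n,1}.$$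 **Assumption A** (with parameters $s,\varkappa$). With $[\Delta x]_t=x_{t-1}$: $x=x^{\mathcal S}+\varepsilon$, where $x^{\mathcal S}$ belongs to a linear subspace $\mathcal S$ of the space of complex two-sided sequences with $\Delta\mathcal S=\mathcal S$ and $\dim\mathcal S=s$, $1\le s\le n+1$, and $\|\Delta^\tau\varepsilon\|_{n,2}\le\sigma\varkappa$ for $0\le\tau\le n$. **Theorem.** There are absolute constants $C,C'>0$ such that the following holds. Let Assumption A hold for some $s$ and $\varkappa<\infty$, let $\varphi^o\in\mathbb C^{n+1}$ satisfy $\|\varphi^o\|^*_{n,1}\le\varrho/\sqrt{n+1}$ for some $\varrho\ge 1$, let $0<\alpha\le 1$, and let $$\lambda\ge\underline\lambda:=60\,\sigma^2\ln[63n/\alpha].$$ Then the Argmin is always nonempty, and there is an event of probability at least $1-\alpha$ on which, for every choice of the minimizer $\widehat\varphi$: 1. $$\|x-\widehat x_{\rm pen}\|_{n,2}\le\|x-\varphi^o*y\|_{n,2}+C\sqrt{\varrho\lambda}+C'\sigma\sqrt{s+(\widehat\varrho+1)\varkappa\sqrt{\ln[16/\alpha]}}\,;$$ if moreover $\alpha\le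 1/2$, then $\ln[16/\alpha]$ can be replaced here by $\ln[1/\alpha]$. 2. If moreover $\varkappa\le\bar\varkappa:=\dfrac{10\ln[42n/\alpha]}{\sqrt{\ln[16/\alpha]}}$ and $\lambda\ge 2\underline\lambda$, then $$\|x-\widehat x_{\rm pen}\|_{n,2}\le\|x-\varphi^o*y\|_{n,2}+C\sqrt{\varrho\lambda}+C'\sigma\sqrt{s}.$$ -/

import Mathlib

open MeasureTheory ProbabilityTheory

noncomputable section

namespace FilterRecovery

/-- The law of a standard complex Gaussian `ξ₁ + i ξ₂` with `ξ₁, ξ₂` independent real `N(0, 1)`. -/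
def stdComplexGaussian : Measure ℂ :=
  ((gaussianReal 0 1).prod (gaussianReal 0 1)).map (fun p : ℝ × ℝ => (⟨p.1, p.2⟩ : ℂ))

/-- The right shift on two-sided sequences, `(Δ x)_t = x_{t-1}`. -/
def shift : (ℤ → ℂ) →ₗ[ℂ] (ℤ → ℂ) where
  toFun x := fun t => x (t - 1)
  map_add' _ _ := rfl
  map_smul' _ _ := rfl

/-- The vector `x_0^n = (x_0, …, x_n)`; its norm is the `ℓ₂`-norm of the sequence on `[0, n]`. -/
def window (n : ℕ) (x : ℤ → ℂ) : EuclideanSpace ℂ (Fin (n + 1)) :=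
  WithLp.toLp 2 (fun t : Fin (n + 1) => x ((t : ℕ) : ℤ))

/-- `norm2 n x = (∑_{t=0}^n |x_t|²)^{1/2}`. -/
def norm2 (n : ℕ) (x : ℤ → ℂ) : ℝ := ‖window n x‖

/-- The convolution `φ * y` of a filter `φ` supported on `[0, n]` (identified with the vector
`(φ_0, …, φ_n)`) with a two-sided sequence `y`. For `0 ≤ t ≤ n` it only involves the values
of `y` on `[-n, n]`. -/
def conv {n : ℕ} (φ : Fin (n + 1) → ℂ) (y : ℤ → ℂ) : ℤ → ℂ :=
  fun t => ∑ τ : Fin (n + 1), φ τ * y (t - ((τ : ℕ) : ℤ))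

/-- The unitary discrete Fourier transform on `ℂ^{n+1}`. -/
def dft {n : ℕ} (z : Fin (n + 1) → ℂ) : Fin (n + 1) → ℂ :=
  fun k => ((1 / Real.sqrt ((n : ℝ) + 1) : ℝ) : ℂ) *
    ∑ t : Fin (n + 1),
      z t * Complex.exp (2 * (Real.pi : ℂ) * Complex.I * ((k : ℕ) : ℂ) * ((t : ℕ) : ℂ)
        / ((n : ℂ) + 1))

/-- The `ℓ₁`-norm of a filter in the spectral domain. -/
def specNorm1 {n : ℕ} (φ : Fin (n + 1) → ℂ) : ℝ := ∑ k : Fin (n + 1), ‖dft φ k‖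

/-- The objective of penalized recovery:
`‖y - φ * y‖² + lam √(n+1) ‖φ‖*₁`, the first norm being the `ℓ₂`-norm on `[0, n]`. -/
def penObjective (n : ℕ) (lam : ℝ) (y : ℤ → ℂ) (φ : Fin (n + 1) → ℂ) : ℝ :=
  norm2 n (y - conv φ y) ^ 2 + lam * Real.sqrt ((n : ℝ) + 1) * specNorm1 φ

/-- `φ` is a filter fitted by penalized recovery: a global minimizer of the objective. -/
def IsPenalizedFilter (n : ℕ) (lam : ℝ) (y : ℤ → ℂ) (φ : Fin (n + 1) → ℂ) : Prop :=
  ∀ ψ : Fin (n + 1) → ℂ, penObjective n lam y φ ≤ penObjective n lam y ψ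

/-- `x` is close to a shift-invariant subspace of dimension `s`, `1 ≤ s ≤ n + 1`:
`x = xS + ε` with `xS` in the subspace and `‖Δ^τ ε‖ ≤ σ ϰ` on `[0, n]` for `0 ≤ τ ≤ n`. -/
def NearShiftInvariant (n s : ℕ) (σ kap : ℝ) (x : ℤ → ℂ) : Prop :=
  1 ≤ s ∧ s ≤ n + 1 ∧
    ∃ S : Submodule ℂ (ℤ → ℂ), S.map shift = S ∧ Module.finrank ℂ S = s ∧
      ∃ xS ∈ S, ∃ ε : ℤ → ℂ, x = xS + ε ∧
        ∀ τ : ℕ, τ ≤ n → norm2 n ((shift ^ τ) ε) ≤ σ * kap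

/-- The noise `ζ_{-n}, …, ζ_n` is an i.i.d. standard complex Gaussian family. -/
def IsStdNoise {Ω : Type*} [MeasurableSpace Ω] (μ : Measure Ω) (n : ℕ) (ζ : ℤ → Ω → ℂ) : Prop :=
  iIndepFun (fun τ : Set.Icc (-(n : ℤ)) (n : ℤ) => ζ τ) μ ∧
    ∀ τ : Set.Icc (-(n : ℤ)) (n : ℤ), HasLaw (ζ τ) stdComplexGaussian μ

/-- The observations `y_τ = x_τ + σ ζ_τ`. Only the indices `-n ≤ τ ≤ n` matter below. -/
def obs {Ω : Type*} (x : ℤ → ℂ) (σ : ℝ) (ζ : ℤ → Ω → ℂ) (ω : Ω) : ℤ → ℂ :=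
  fun τ => x τ + (σ : ℂ) * ζ τ ω

/-- The threshold `60 σ² ln(63 n / α)` for the regularization parameter. -/
def lamLow (n : ℕ) (σ α : ℝ) : ℝ := 60 * σ ^ 2 * Real.log (63 * n / α)

/-- The threshold `10 ln(42 n / α) / √(ln(16 / α))` for the deterministic error. -/
def kapBar (n : ℕ) (α : ℝ) : ℝ :=
  10 * Real.log (42 * n / α) / Real.sqrt (Real.log (16 / α))

/-- The normalized spectral norm `√(n+1) ‖φ‖*₁` of a filter. -/
def normSpec {n : ℕ} (φ : Fin (n + 1) → ℂ) : ℝ := Real.sqrt ((n : ℝ) + 1) * specNorm1 φ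

end FilterRecovery

end

noncomputable section

namespace FilterRecovery

open scoped ENNReal

section

/-! ### Exponential moments of Gaussian vectors -/

/-! Comparing the objective at the minimizer `φ` and at `φo` (`IsPenalizedFilter.basic_inequality`)
reduces everything to the correlations of the noise `z` with the two residuals. For `φo` the
noise-free residual is deterministic, so its correlation is a single Gaussian, and what remains is
the quadratic term in `z` and `φo * z`. For the data-dependent `φ` a bound uniform in the filter is
needed. Let `K` be the window of the subspace `S`. The projection of `z` on `K` has squared norm of
order `s + log (1/α)`. The orthogonal part does not see `xS - φ * xS`, because filters preserve `S`;
it meets `ε - φ * ε`, which is a combination of fixed small vectors, and the chaos `φ * z`. The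
chaos is the crux. It is linear in `φ`, so Fourier inversion reduces it to `n + 1` exponential
filters (`norm_inner_window_conv_le`). For one exponential, convolution is a modulated triangular
truncation: half of a rank-one matrix plus half of a skew-circulant one, whose normalized
eigenvalues sum to `O(log n)` (`inner_window_conv_charVec`, `sum_skewWeight_le`). The chaos is thus
at most `normSpec φ` times `30 log (63 n / α)`, and the penalty absorbs it: this is the origin of
the threshold `60 σ² log (63 n / α)`. All tails come from one exponential moment bound,
`lintegral_exp_sum_normSq_inner_le`. A quadratic inequality for the error then closes the argument
(`residual_le_of_quadratic`). -/

instance : IsProbabilityMeasure stdComplexGaussian :=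
  Measure.isProbabilityMeasure_map (by
    exact Measurable.aemeasurable (by
      exact Complex.measurableEquivRealProd.symm.measurable))

lemma lintegral_stdComplexGaussian {f : ℂ → ℝ≥0∞} (hf : Measurable f) :
    ∫⁻ z, f z ∂stdComplexGaussian =
      ∫⁻ p : ℝ × ℝ, f ⟨p.1, p.2⟩ ∂((gaussianReal 0 1).prod (gaussianReal 0 1)) := by
  rw [stdComplexGaussian, lintegral_map hf]
  exact Complex.measurableEquivRealProd.symm.measurable

lemma lintegral_exp_mul_gaussianReal (t : ℝ) :
    ∫⁻ x, ENNReal.ofReal (Real.exp (t * x)) ∂(gaussianReal 0 1)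
      = ENNReal.ofReal (Real.exp (t ^ 2 / 2)) := by
  rw [← ofReal_integral_eq_lintegral_ofReal (integrable_exp_mul_gaussianReal t)
    (Filter.Eventually.of_forall fun _ => (Real.exp_pos _).le)]
  have h := congrFun (mgf_fun_id_gaussianReal (μ := 0) (v := 1)) t
  simp only [mgf] at h
  rw [h]; simp

lemma lintegral_exp_sq_gaussianReal {θ : ℝ} (h1 : θ < 1) :
    ∫⁻ x, ENNReal.ofReal (Real.exp (θ * x ^ 2 / 2)) ∂(gaussianReal 0 1)
      = ENNReal.ofReal (Real.sqrt (1 - θ)⁻¹) := by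
  have hb : (0 : ℝ) < (1 - θ) / 2 := by linarith
  rw [gaussianReal_of_var_ne_zero _ one_ne_zero,
    lintegral_withDensity_eq_lintegral_mul _ (measurable_gaussianPDF 0 1) (by fun_prop)]
  have : ∀ x : ℝ, (gaussianPDF 0 1 * fun x => ENNReal.ofReal (Real.exp (θ * x ^ 2 / 2))) x
      = ENNReal.ofReal ((Real.sqrt (2 * Real.pi))⁻¹ * Real.exp (-((1 - θ) / 2) * x ^ 2)) := by
    intro x
    rw [Pi.mul_apply, gaussianPDF, ← ENNReal.ofReal_mul (gaussianPDFReal_nonneg _ _ _),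
      gaussianPDFReal, mul_assoc, ← Real.exp_add]
    congr 3
    · simp
    · simp; ring
  simp_rw [this]
  rw [← ofReal_integral_eq_lintegral_ofReal ((integrable_exp_neg_mul_sq hb).const_mul _)
    (Filter.Eventually.of_forall fun _ => by positivity), integral_const_mul, integral_gaussian]
  congr 1
  rw [← Real.sqrt_inv, ← Real.sqrt_mul (by positivity)]
  congr 1
  have : (1 - θ) ≠ 0 := by linarith
  field_simp

lemma lintegral_exp_re_stdComplexGaussian (a : ℂ) :
    ∫⁻ z, ENNReal.ofReal (Real.exp (star a * z).re) ∂stdComplexGaussian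
      = ENNReal.ofReal (Real.exp (‖a‖ ^ 2 / 2)) := by
  rw [lintegral_stdComplexGaussian (by fun_prop)]
  have : ∀ p : ℝ × ℝ, ENNReal.ofReal (Real.exp (star a * (⟨p.1, p.2⟩ : ℂ)).re)
      = ENNReal.ofReal (Real.exp (a.re * p.1)) * ENNReal.ofReal (Real.exp (a.im * p.2)) := by
    intro p
    rw [← ENNReal.ofReal_mul (Real.exp_pos _).le, ← Real.exp_add]
    simp
  simp_rw [this]
  rw [lintegral_prod_mul (f := fun x => ENNReal.ofReal (Real.exp (a.re * x)))
    (g := fun x => ENNReal.ofReal (Real.exp (a.im * x))) (by fun_prop) (by fun_prop),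
    lintegral_exp_mul_gaussianReal, lintegral_exp_mul_gaussianReal,
    ← ENNReal.ofReal_mul (Real.exp_pos _).le, ← Real.exp_add, Complex.sq_norm,
    Complex.normSq_apply]
  congr 2; ring

lemma lintegral_exp_normSq_stdComplexGaussian_le {θ : ℝ} (h0 : 0 ≤ θ) (h1 : θ ≤ 1 / 2) :
    ∫⁻ z, ENNReal.ofReal (Real.exp (θ * ‖z‖ ^ 2 / 2)) ∂stdComplexGaussian
      ≤ ENNReal.ofReal (Real.exp (2 * θ)) := by
  rw [lintegral_stdComplexGaussian (by fun_prop)]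
  have : ∀ p : ℝ × ℝ, ENNReal.ofReal (Real.exp (θ * ‖(⟨p.1, p.2⟩ : ℂ)‖ ^ 2 / 2))
      = ENNReal.ofReal (Real.exp (θ * p.1 ^ 2 / 2))
        * ENNReal.ofReal (Real.exp (θ * p.2 ^ 2 / 2)) := by
    intro p
    rw [← ENNReal.ofReal_mul (Real.exp_pos _).le, ← Real.exp_add, Complex.sq_norm,
      Complex.normSq_apply]
    congr 2; ring
  simp_rw [this]
  rw [lintegral_prod_mul (f := fun x => ENNReal.ofReal (Real.exp (θ * x ^ 2 / 2)))
    (g := fun x => ENNReal.ofReal (Real.exp (θ * x ^ 2 / 2))) (by fun_prop) (by fun_prop),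
    lintegral_exp_sq_gaussianReal (by linarith), ← ENNReal.ofReal_mul (Real.sqrt_nonneg _),
    Real.mul_self_sqrt (inv_nonneg.2 (by linarith))]
  apply ENNReal.ofReal_le_ofReal
  -- The moment is `1 / (1 - θ)`, and `(1 - θ) (1 + 2θ) ≥ 1` holds because `0 ≤ θ ≤ 1/2`.
  have := Real.add_one_le_exp (2 * θ)
  rw [inv_le_iff_one_le_mul₀ (by linarith)]
  nlinarith

/-- The law of `ι` independent standard complex Gaussians. -/
abbrev piGaussian (ι : Type*) [Fintype ι] : Measure (ι → ℂ) :=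
  Measure.pi fun _ : ι => stdComplexGaussian

variable {ι J : Type*} [Fintype ι] [Fintype J]

lemma lintegral_prod_piGaussian {f : ι → ℂ → ℝ≥0∞} (hf : ∀ i, Measurable (f i)) :
    ∫⁻ z, ∏ i, f i (z i) ∂piGaussian ι = ∏ i, ∫⁻ z, f i z ∂stdComplexGaussian := by
  rw [lintegral_prod_eq_prod_lintegral_of_indepFun Finset.univ (fun i (z : ι → ℂ) => f i (z i))
    (iIndepFun_pi fun i => (hf i).aemeasurable) (fun i => (hf i).comp (measurable_pi_apply i))]
  refine Finset.prod_congr rfl fun i _ => ?_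
  rw [← (measurePreserving_eval (fun _ : ι => stdComplexGaussian) i).lintegral_comp (hf i)]

lemma lintegral_exp_re_inner_piGaussian (u : EuclideanSpace ℂ ι) :
    ∫⁻ z, ENNReal.ofReal (Real.exp (inner ℂ u (WithLp.toLp 2 z)).re) ∂piGaussian ι
      = ENNReal.ofReal (Real.exp (‖u‖ ^ 2 / 2)) := by
  have : ∀ z : ι → ℂ, ENNReal.ofReal (Real.exp (inner ℂ u (WithLp.toLp 2 z)).re)
      = ∏ i, ENNReal.ofReal (Real.exp (star (u i) * z i).re) := by
    intro z
    rw [← ENNReal.ofReal_prod_of_nonneg fun _ _ => (Real.exp_pos _).le, ← Real.exp_sum,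
      PiLp.inner_apply, Complex.re_sum]
    simp [mul_comm]
  simp_rw [this]
  rw [lintegral_prod_piGaussian (f := fun i z => ENNReal.ofReal (Real.exp (star (u i) * z).re))
    fun i => by fun_prop]
  simp_rw [lintegral_exp_re_stdComplexGaussian]
  rw [← ENNReal.ofReal_prod_of_nonneg fun _ _ => (Real.exp_pos _).le, ← Real.exp_sum,
    EuclideanSpace.norm_sq_eq, Finset.sum_div]

/-- If `∑ g_j u_j` has squared norm at most `∑ θ_j |g_j|²` for all coefficients `g`, then the
exponential moment of `½ ∑ |⟨u_j, z⟩|²` is at most what it would be for an orthogonal family. -/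
theorem lintegral_exp_sum_normSq_inner_le (u : J → EuclideanSpace ℂ ι) (θ : J → ℝ)
    (h0 : ∀ j, 0 ≤ θ j) (h1 : ∀ j, θ j ≤ 1 / 2)
    (hu : ∀ g : J → ℂ, ‖∑ j, g j • u j‖ ^ 2 ≤ ∑ j, θ j * ‖g j‖ ^ 2) :
    ∫⁻ z, ENNReal.ofReal (Real.exp ((∑ j, ‖inner ℂ (u j) (WithLp.toLp 2 z)‖ ^ 2) / 2))
      ∂piGaussian ι ≤ ENNReal.ofReal (Real.exp (2 * ∑ j, θ j)) := by
  -- Gaussian linearization: `exp (‖a‖² / 2)` is the mean of `exp (Re ⟨a, g⟩)` over an auxiliary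
  -- Gaussian `g`. After exchanging the integrals, `z` integrates out exactly and leaves `exp (‖∑
  -- g_j u_j‖² / 2)`, to which `hu` applies.
  have key : ∀ z : ι → ℂ,
      ENNReal.ofReal (Real.exp ((∑ j, ‖inner ℂ (u j) (WithLp.toLp 2 z)‖ ^ 2) / 2))
      = ∫⁻ g, ENNReal.ofReal (Real.exp
          (inner ℂ (∑ j, g j • u j) (WithLp.toLp 2 z)).re) ∂piGaussian J := by
    intro z
    have h := lintegral_exp_re_inner_piGaussian
      (WithLp.toLp 2 fun j => inner ℂ (u j) (WithLp.toLp 2 z) : EuclideanSpace ℂ J)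
    rw [EuclideanSpace.norm_sq_eq] at h
    rw [← h]
    refine lintegral_congr fun g => ?_
    congr 2
    rw [sum_inner, PiLp.inner_apply, Complex.re_sum, Complex.re_sum]
    refine Finset.sum_congr rfl fun j _ => ?_
    simp only [inner_smul_left, RCLike.inner_apply]
    rw [← Complex.conj_re, map_mul, Complex.conj_conj]
  simp_rw [key]
  rw [lintegral_lintegral_swap]
  · simp_rw [lintegral_exp_re_inner_piGaussian]
    calc ∫⁻ g, ENNReal.ofReal (Real.exp (‖∑ j, g j • u j‖ ^ 2 / 2)) ∂piGaussian J
        ≤ ∫⁻ g, ∏ j, ENNReal.ofReal (Real.exp (θ j * ‖g j‖ ^ 2 / 2)) ∂piGaussian J := by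
          refine lintegral_mono fun g => ?_
          rw [← ENNReal.ofReal_prod_of_nonneg fun _ _ => (Real.exp_pos _).le, ← Real.exp_sum,
            ← Finset.sum_div]
          exact ENNReal.ofReal_le_ofReal (Real.exp_le_exp.2
            (div_le_div_of_nonneg_right (hu g) (by norm_num)))
      _ = ∏ j, ∫⁻ z, ENNReal.ofReal (Real.exp (θ j * ‖z‖ ^ 2 / 2)) ∂stdComplexGaussian :=
          lintegral_prod_piGaussian
            (f := fun j z => ENNReal.ofReal (Real.exp (θ j * ‖z‖ ^ 2 / 2))) fun j => by fun_prop
      _ ≤ ∏ j, ENNReal.ofReal (Real.exp (2 * θ j)) :=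
          Finset.prod_le_prod' fun j _ =>
            lintegral_exp_normSq_stdComplexGaussian_le (h0 j) (h1 j)
      _ = _ := by
          rw [← ENNReal.ofReal_prod_of_nonneg fun _ _ => (Real.exp_pos _).le, ← Real.exp_sum,
            Finset.mul_sum]
  · refine Measurable.aemeasurable ?_
    refine ENNReal.measurable_ofReal.comp (Real.measurable_exp.comp
      (Complex.measurable_re.comp (Continuous.measurable ?_)))
    fun_prop

end

section

/-! ### Roots of unity -/

/-- The root of unity `exp(2πi/N)`. -/
def rootOne (N : ℕ) : ℂ := Complex.exp (2 * Real.pi * Complex.I / N)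

/-- The root of minus one `exp(πi(2j+1)/N)`. -/
def rootNegOne (N j : ℕ) : ℂ := Complex.exp (Complex.I * ((Real.pi * (2 * j + 1) / N : ℝ) : ℂ))

variable {N : ℕ}

lemma rootOne_isPrimitiveRoot (hN : N ≠ 0) : IsPrimitiveRoot (rootOne N) N :=
  Complex.isPrimitiveRoot_exp N hN

lemma rootNegOne_ne_zero (N j : ℕ) : rootNegOne N j ≠ 0 := Complex.exp_ne_zero _

lemma norm_rootNegOne (N j : ℕ) : ‖rootNegOne N j‖ = 1 := Complex.norm_exp_I_mul_ofReal _

lemma rootNegOne_eq (N j : ℕ) : rootNegOne N j = rootNegOne N 0 * rootOne N ^ j := by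
  simp only [rootNegOne, rootOne, ← Complex.exp_nat_mul, ← Complex.exp_add]
  congr 1
  push_cast
  ring

lemma rootNegOne_pow (hN : N ≠ 0) (j : ℕ) : rootNegOne N j ^ N = -1 := by
  have : (N : ℂ) ≠ 0 := by exact_mod_cast hN
  rw [rootNegOne, ← Complex.exp_nat_mul,
    show (N : ℂ) * (Complex.I * ((Real.pi * (2 * j + 1) / N : ℝ) : ℂ))
      = Real.pi * Complex.I + j * (2 * Real.pi * Complex.I) by push_cast; field_simp; ring,
    Complex.exp_add, Complex.exp_nat_mul_two_pi_mul_I, Complex.exp_pi_mul_I, mul_one]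

lemma sum_zpow_rootOne (hN : N ≠ 0) (d : ℤ) :
    ∑ k : Fin N, (rootOne N ^ d) ^ (k : ℕ) = if (N : ℤ) ∣ d then (N : ℂ) else 0 := by
  have hp := rootOne_isPrimitiveRoot hN
  split_ifs with h
  · rw [(hp.zpow_eq_one_iff_dvd d).2 h]; simp
  · have h1 : rootOne N ^ d ≠ 1 := fun h' => h ((hp.zpow_eq_one_iff_dvd d).1 h')
    rw [Fin.sum_univ_eq_sum_range (fun k => (rootOne N ^ d) ^ k), geom_sum_eq h1, ← zpow_natCast,
      ← zpow_mul, mul_comm, zpow_mul, zpow_natCast, hp.pow_eq_one]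
    simp

lemma dvd_sub_fin_iff (s t : Fin N) : (N : ℤ) ∣ ((s : ℕ) : ℤ) - ((t : ℕ) : ℤ) ↔ s = t := by
  constructor
  · rintro ⟨c, hc⟩
    have hs := s.2
    have ht := t.2
    have : c = 0 := by
      rcases lt_trichotomy c 0 with h | h | h
      · nlinarith
      · exact h
      · nlinarith
    subst this
    ext; omega
  · rintro rfl; simp

/-- The eigenvalues of the skew-circulant matrix with entries `1` on and below the diagonal and
`-1` above. -/
def skewEig (N j : ℕ) : ℂ := ∑ m : Fin N, (rootNegOne N j)⁻¹ ^ (m : ℕ)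

/-- Spectral decomposition of the sign matrix. The `N`-th roots of `-1` form a coset of the roots of
unity, so orthogonality keeps only the index `m` congruent to `t - s` modulo `N`. -/
lemma sum_skewEig_mul (hN : N ≠ 0) (t s : Fin N) :
    ∑ j : Fin N, skewEig N j * rootNegOne N j ^ (((t : ℕ) : ℤ) - ((s : ℕ) : ℤ))
      = if s ≤ t then (N : ℂ) else -N := by
  have hp := rootOne_isPrimitiveRoot hN
  have h0 : rootOne N ≠ 0 := hp.ne_zero hN
  set d : ℤ := ((t : ℕ) : ℤ) - ((s : ℕ) : ℤ) with hd
  have e1 : ∀ j m : Fin N, (rootNegOne N j)⁻¹ ^ (m : ℕ) * rootNegOne N j ^ d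
      = rootNegOne N 0 ^ (d - (m : ℕ)) * (rootOne N ^ (d - (m : ℕ))) ^ (j : ℕ) := by
    intro j m
    rw [inv_pow, ← zpow_natCast, ← zpow_neg, ← zpow_add₀ (rootNegOne_ne_zero N j), rootNegOne_eq,
      mul_zpow, ← zpow_natCast, ← zpow_natCast, ← zpow_mul, ← zpow_mul,
      show -((m : ℕ) : ℤ) + d = d - (m : ℕ) by ring, mul_comm ((j : ℕ) : ℤ)]
  simp_rw [skewEig, Finset.sum_mul, e1]
  rw [Finset.sum_comm]
  simp_rw [← Finset.mul_sum, sum_zpow_rootOne hN]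
  have hN0 : 0 < N := Nat.pos_of_ne_zero hN
  have hs := s.2
  have ht := t.2
  split_ifs with hst
  · have hst' : (s : ℕ) ≤ t := hst
    rw [Finset.sum_eq_single (⟨t - s, by omega⟩ : Fin N)]
    · have : d - (((⟨t - s, by omega⟩ : Fin N) : ℕ) : ℤ) = 0 := by simp only [hd]; omega
      rw [this]; simp
    · intro m _ hm
      rw [if_neg, mul_zero]
      intro hdiv
      apply hm
      have := (dvd_sub_fin_iff (⟨t - s, by omega⟩ : Fin N) m).1 (by
        convert hdiv using 2; simp only [hd]; omega)
      exact this.symm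
    · simp
  · have hst' : (t : ℕ) < s := by
      have := not_le.1 hst
      exact this
    -- Above the diagonal the surviving index wraps around once, which costs the factor `rootNegOne
    -- N 0 ^ (-N) = -1`.
    rw [Finset.sum_eq_single (⟨t + N - s, by omega⟩ : Fin N)]
    · have : d - (((⟨t + N - s, by omega⟩ : Fin N) : ℕ) : ℤ) = -N := by simp only [hd]; omega
      rw [this, zpow_neg, zpow_natCast, rootNegOne_pow hN]; simp
    · intro m _ hm
      rw [if_neg, mul_zero]
      intro hdiv
      apply hm
      have := (dvd_sub_fin_iff (⟨t + N - s, by omega⟩ : Fin N) m).1 (by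
        have h2 := (dvd_add_right (dvd_refl (N : ℤ))).2 hdiv
        rwa [show (N : ℤ) + (d - (m : ℕ))
          = (((⟨t + N - s, by omega⟩ : Fin N) : ℕ) : ℤ) - (m : ℕ) by simp only [hd]; omega] at h2)
      exact this.symm
    · simp

/-- The normalized moduli of the eigenvalues `skewEig`. -/
def skewWeight (N j : ℕ) : ℝ := ‖skewEig N j‖ / N

lemma skewWeight_nonneg (N j : ℕ) : 0 ≤ skewWeight N j := by unfold skewWeight; positivity

lemma skewWeight_le_one (N j : ℕ) : skewWeight N j ≤ 1 := by
  refine div_le_one_of_le₀ ?_ (Nat.cast_nonneg N)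
  refine (norm_sum_le _ _).trans ?_
  simp [norm_rootNegOne]

/-- Summing the geometric series gives modulus `1 / |sin x|` with `x = π(2j+1)/(2N)`. Jordan's
inequality `sin x ≥ 2x/π`, applied to `x` or to `π - x`, yields harmonic decay from either end,
hence a logarithmic sum. -/
lemma skewWeight_le (hN : N ≠ 0) {j : ℕ} (hj : j < N) :
    skewWeight N j ≤ 1 / ((j : ℝ) + 1) + 1 / ((N : ℝ) - j) := by
  have hN0 : (0 : ℝ) < N := by exact_mod_cast Nat.pos_of_ne_zero hN
  have hj' : (j : ℝ) + 1 ≤ N := by exact_mod_cast hj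
  have hω : (rootNegOne N j)⁻¹ ^ N = -1 := by rw [inv_pow, rootNegOne_pow hN]; norm_num
  have hne : (rootNegOne N j)⁻¹ ≠ 1 := by
    intro h; rw [h, one_pow] at hω; norm_num at hω
  set x : ℝ := Real.pi * (2 * j + 1) / N / 2 with hx
  have hnorm : ‖(rootNegOne N j)⁻¹ - 1‖ = 2 * |Real.sin x| := by
    have h1 : (rootNegOne N j)⁻¹ - 1 = -(rootNegOne N j)⁻¹ * (rootNegOne N j - 1) := by
      field_simp [rootNegOne_ne_zero N j]; ring
    rw [h1, norm_mul, norm_neg, norm_inv, norm_rootNegOne, rootNegOne,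
      Complex.norm_exp_I_mul_ofReal_sub_one]
    simp [hx]
  have hsk : ‖skewEig N j‖ * |Real.sin x| = 1 := by
    have h2 : skewEig N j * ((rootNegOne N j)⁻¹ - 1) = -2 := by
      rw [skewEig, Fin.sum_univ_eq_sum_range (fun k => (rootNegOne N j)⁻¹ ^ k), geom_sum_mul, hω]
      norm_num
    have h3 := congrArg norm h2
    rw [norm_mul, hnorm] at h3
    norm_num at h3
    linarith
  have hpi := Real.pi_pos
  have hx0 : 0 ≤ x := by positivity
  have hw : skewWeight N j * (N * |Real.sin x|) = 1 := by
    rw [skewWeight, ← hsk]; field_simp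
  have hw0 := skewWeight_nonneg N j
  by_cases hxp : x ≤ Real.pi / 2
  · have hs := Real.mul_le_sin hx0 hxp
    have : 2 / Real.pi * x = (2 * j + 1) / N := by rw [hx]; field_simp
    rw [this] at hs
    have h4 : (2 * j + 1 : ℝ) ≤ N * Real.sin x := by
      rwa [div_le_iff₀ hN0, mul_comm (Real.sin x)] at hs
    have h5 := mul_le_mul_of_nonneg_left (le_abs_self (Real.sin x)) hN0.le
    have hj0 : (0 : ℝ) ≤ j := Nat.cast_nonneg j
    have : skewWeight N j ≤ 1 / ((j : ℝ) + 1) := by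
      rw [le_div_iff₀ (by positivity), ← hw]
      exact mul_le_mul_of_nonneg_left (by linarith) hw0
    have h6 : 0 ≤ 1 / ((N : ℝ) - j) := div_nonneg zero_le_one (by linarith)
    linarith
  · have hs := Real.mul_le_sin (x := Real.pi - x) (by
      have : x ≤ Real.pi * (2 * N) / N / 2 := by
        rw [hx]; gcongr; linarith
      have h7 : Real.pi * (2 * N) / N / 2 = Real.pi := by field_simp
      linarith) (by linarith)
    rw [Real.sin_pi_sub] at hs
    have : 2 / Real.pi * (Real.pi - x) = (2 * N - 2 * j - 1) / N := by rw [hx]; field_simp; ring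
    rw [this] at hs
    have h4 : (2 * N - 2 * j - 1 : ℝ) ≤ N * Real.sin x := by
      rwa [div_le_iff₀ hN0, mul_comm (Real.sin x)] at hs
    have h5 := mul_le_mul_of_nonneg_left (le_abs_self (Real.sin x)) hN0.le
    have : skewWeight N j ≤ 1 / ((N : ℝ) - j) := by
      rw [le_div_iff₀ (by linarith), ← hw]
      exact mul_le_mul_of_nonneg_left (by linarith) hw0
    have h6 : 0 ≤ 1 / ((j : ℝ) + 1) := by positivity
    linarith

lemma sum_skewWeight_le (hN : N ≠ 0) :
    ∑ j : Fin N, skewWeight N j ≤ 2 + 2 * Real.log N := by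
  have h1 : ∑ j ∈ Finset.range N, 1 / ((j : ℝ) + 1) ≤ 1 + Real.log N := by
    have := harmonic_le_one_add_log N
    refine le_trans (le_of_eq ?_) this
    rw [harmonic]; push_cast; simp
  have h2 : ∑ j ∈ Finset.range N, 1 / ((N : ℝ) - j) = ∑ j ∈ Finset.range N, 1 / ((j : ℝ) + 1) := by
    rw [← Finset.sum_range_reflect]
    refine Finset.sum_congr rfl fun j hj => ?_
    have : j + 1 ≤ N := Finset.mem_range.1 hj
    rw [show N - 1 - j = N - (j + 1) by omega, Nat.cast_sub this]
    congr 1; push_cast; ring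
  rw [Fin.sum_univ_eq_sum_range (fun j => skewWeight N j)]
  calc ∑ j ∈ Finset.range N, skewWeight N j
      ≤ ∑ j ∈ Finset.range N, (1 / ((j : ℝ) + 1) + 1 / ((N : ℝ) - j)) :=
        Finset.sum_le_sum fun j hj => skewWeight_le hN (Finset.mem_range.1 hj)
    _ ≤ _ := by rw [Finset.sum_add_distrib, h2]; linarith

end

section

/-! ### Convolution with exponential filters -/

variable {n : ℕ}

/-- The vector `(1, u, …, u^n)`. -/
def charVec (n : ℕ) (u : ℂ) : EuclideanSpace ℂ (Fin (n + 1)) :=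
  WithLp.toLp 2 fun t : Fin (n + 1) => u ^ (t : ℕ)

/-- The `s`-th index among `0, -n, …, -1`. -/
def negIndex (s : Fin (n + 1)) : ℤ := if s = 0 then 0 else ((s : ℕ) : ℤ) - (n + 1)

/-- The vector `(z_0, z_{-n}, …, z_{-1})`. -/
def negWindow (n : ℕ) (z : ℤ → ℂ) : EuclideanSpace ℂ (Fin (n + 1)) :=
  WithLp.toLp 2 fun s : Fin (n + 1) => z (negIndex s)

lemma inner_charVec {u : ℂ} (hu : ‖u‖ = 1) (p : EuclideanSpace ℂ (Fin (n + 1))) :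
    inner ℂ (charVec n u) p = ∑ t : Fin (n + 1), u⁻¹ ^ (t : ℕ) * p t := by
  rw [PiLp.inner_apply]
  refine Finset.sum_congr rfl fun t _ => ?_
  rw [Complex.inv_eq_conj hu]
  simp [charVec, mul_comm]

lemma inner_charVec_right (u : ℂ) (p : EuclideanSpace ℂ (Fin (n + 1))) :
    inner ℂ p (charVec n u) = ∑ t : Fin (n + 1), star (p t) * u ^ (t : ℕ) := by
  rw [PiLp.inner_apply]
  refine Finset.sum_congr rfl fun t _ => ?_
  simp [charVec, mul_comm]

/-- Reindexing by `τ = t - s` modulo `n + 1` leaves the weight unaffected by the wrap, since `w ^ (n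
+ 1) = 1`; only the sample of `z` moves to the past. -/
lemma conv_charVec_apply {w : ℂ} (hw : w ^ (n + 1) = 1) (z : ℤ → ℂ) (t : Fin (n + 1)) :
    conv (charVec n w) z ((t : ℕ) : ℤ) = w ^ (t : ℕ) * ∑ s : Fin (n + 1),
      w⁻¹ ^ (s : ℕ) * (if s ≤ t then z ((s : ℕ) : ℤ) else z (((s : ℕ) : ℤ) - (n + 1))) := by
  have hw0 : w ≠ 0 := by rintro rfl; simp at hw
  rw [conv, ← Equiv.sum_comp (Equiv.subLeft t), Finset.mul_sum]
  refine Finset.sum_congr rfl fun s _ => ?_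
  have hs := s.2
  have ht := t.2
  simp only [Equiv.subLeft_apply, charVec]
  split_ifs with h
  · have h' : (s : ℕ) ≤ t := h
    rw [Fin.coe_sub_iff_le.2 h, pow_sub₀ w hw0 h', inv_pow, mul_assoc]
    congr 3
    omega
  · have h' : (t : ℕ) < s := not_le.1 h
    rw [Fin.coe_sub_iff_lt.2 (not_le.1 h), pow_sub₀ w hw0 (by omega), pow_add, hw, one_mul, inv_pow,
      mul_assoc]
    congr 3
    omega

/-- The indicator of `s ≤ t` equals `(1 + sign) / 2`. The constant part gives a rank-one term and
the sign part is diagonal in the characters at roots of `-1`; modulation by `w` only shifts the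
frequencies. -/
lemma inner_window_conv_charVec {w : ℂ} (hw : w ^ (n + 1) = 1) (hw1 : ‖w‖ = 1) (z : ℤ → ℂ)
    (p : EuclideanSpace ℂ (Fin (n + 1))) :
    inner ℂ p (window n (conv (charVec n w) z)) =
      (inner ℂ p (charVec n w) * inner ℂ (charVec n w) (window n z + negWindow n z)
        + ∑ j : Fin (n + 1), skewEig (n + 1) j / (n + 1) *
          (inner ℂ p (charVec n (w * rootNegOne (n + 1) j)) *
            inner ℂ (charVec n (w * rootNegOne (n + 1) j)) (window n z - negWindow n z))) / 2 := by
  have hN : ((n : ℂ) + 1) ≠ 0 := by exact_mod_cast Nat.succ_ne_zero n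
  have hw0 : w ≠ 0 := by rintro rfl; simp at hw
  have hK : ∀ s t : Fin (n + 1), ∑ j : Fin (n + 1), skewEig (n + 1) j / (n + 1) *
      (rootNegOne (n + 1) j ^ (t : ℕ) * (rootNegOne (n + 1) j)⁻¹ ^ (s : ℕ))
      = if s ≤ t then 1 else -1 := by
    intro s t
    have h := sum_skewEig_mul (Nat.succ_ne_zero n) t s
    have h2 : ∀ j : Fin (n + 1), skewEig (n + 1) j / (n + 1) *
      (rootNegOne (n + 1) j ^ (t : ℕ) * (rootNegOne (n + 1) j)⁻¹ ^ (s : ℕ))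
      = skewEig (n + 1) j * rootNegOne (n + 1) j ^ (((t : ℕ) : ℤ) - ((s : ℕ) : ℤ)) / (n + 1) := by
      intro j
      rw [zpow_sub₀ (rootNegOne_ne_zero _ _), zpow_natCast, zpow_natCast, inv_pow]
      ring
    simp_rw [h2]
    rw [← Finset.sum_div]
    simp only [Nat.succ_eq_add_one] at h
    rw [h]
    push_cast
    split_ifs <;> field_simp
  have hz : ∀ s t : Fin (n + 1),
      (if s ≤ t then z ((s : ℕ) : ℤ) else z (((s : ℕ) : ℤ) - (n + 1))) =
      ((window n z s + negWindow n z s) + (if s ≤ t then 1 else -1) *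
        (window n z s - negWindow n z s)) / 2 := by
    intro s t
    split_ifs with h
    · simp [window]
    -- The entry `s = 0` of the past never matters, so its value is free. `negIndex` puts `0` there
    -- because `-(n + 1)` lies outside the range of the noise.
    · have hs : s ≠ 0 := by rintro rfl; exact h (Fin.zero_le t)
      simp only [window, negWindow, negIndex, hs, if_false]
      ring
  have hnorm : ∀ j, ‖w * rootNegOne (n + 1) j‖ = 1 := fun j => by
    rw [norm_mul, hw1, norm_rootNegOne, one_mul]
  have hq := fun (j : Fin (n + 1)) => inner_charVec (n := n) (hnorm j)
  rw [PiLp.inner_apply]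
  simp_rw [hq, inner_charVec hw1, inner_charVec_right]
  have hL : ∀ t : Fin (n + 1), inner ℂ (p t) (window n (conv (charVec n w) z) t)
      = (star (p t) * w ^ (t : ℕ) * ∑ s : Fin (n + 1), w⁻¹ ^ (s : ℕ) *
          (window n z s + negWindow n z s)
        + ∑ j : Fin (n + 1), skewEig (n + 1) j / (n + 1) *
          (star (p t) * (w * rootNegOne (n + 1) j) ^ (t : ℕ) *
            ∑ s : Fin (n + 1), (w * rootNegOne (n + 1) j)⁻¹ ^ (s : ℕ) *
              (window n z s - negWindow n z s))) / 2 := by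
    intro t
    have h1 : inner ℂ (p t) (window n (conv (charVec n w) z) t)
        = star (p t) * conv (charVec n w) z ((t : ℕ) : ℤ) := by
      simp [window, mul_comm]
    rw [h1, conv_charVec_apply hw]
    have e : ∀ s : Fin (n + 1),
        w⁻¹ ^ (s : ℕ) * (if s ≤ t then z ((s : ℕ) : ℤ) else z (((s : ℕ) : ℤ) - (n + 1))) =
        (w⁻¹ ^ (s : ℕ) * (window n z s + negWindow n z s) + ∑ j : Fin (n + 1),
          skewEig (n + 1) j / (n + 1) *
            (rootNegOne (n + 1) j ^ (t : ℕ) * (rootNegOne (n + 1) j)⁻¹ ^ (s : ℕ)) *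
          (w⁻¹ ^ (s : ℕ) * (window n z s - negWindow n z s))) / 2 := by
      intro s
      rw [hz s t, ← Finset.sum_mul, hK s t]
      ring
    rw [Finset.sum_congr rfl fun s _ => e s, ← Finset.sum_div, Finset.sum_add_distrib,
      Finset.sum_comm, mul_div_assoc', mul_div_assoc', mul_add, mul_add]
    congr 2
    · ring
    · simp_rw [Finset.mul_sum]
      refine Finset.sum_congr rfl fun j _ => Finset.sum_congr rfl fun s _ => ?_
      rw [mul_pow, mul_inv, mul_pow]
      ring
  simp_rw [hL]
  rw [← Finset.sum_div, Finset.sum_add_distrib, ← Finset.sum_mul, Finset.sum_comm]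
  simp_rw [← Finset.mul_sum, ← Finset.sum_mul]
  simp

/-- The quadratic form which controls convolutions with the exponential filter of frequency `w`. -/
def convForm (n : ℕ) (w : ℂ) (p : EuclideanSpace ℂ (Fin (n + 1))) : ℝ :=
  ‖inner ℂ (charVec n w) p‖ ^ 2 + ∑ j : Fin (n + 1), skewWeight (n + 1) j *
    ‖inner ℂ (charVec n (w * rootNegOne (n + 1) j)) p‖ ^ 2

/-- The arithmetic-geometric inequality separates `p` from the two windows of `z`, so that no
independence between them is needed later. -/
lemma norm_inner_window_conv_charVec_le {w : ℂ} (hw : w ^ (n + 1) = 1) (hw1 : ‖w‖ = 1)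
    (z : ℤ → ℂ) (p : EuclideanSpace ℂ (Fin (n + 1))) :
    ‖inner ℂ p (window n (conv (charVec n w) z))‖ ≤
      convForm n w p / 2 + convForm n w (window n z) / 4 + convForm n w (negWindow n z) / 4 := by
  have amgm : ∀ (u a b : EuclideanSpace ℂ (Fin (n + 1))), ‖inner ℂ p u * inner ℂ u a‖ +
      ‖inner ℂ p u * inner ℂ u b‖ ≤
        ‖inner ℂ u p‖ ^ 2 + ‖inner ℂ u a‖ ^ 2 / 2 + ‖inner ℂ u b‖ ^ 2 / 2 := by
    intro u a b
    rw [norm_mul, norm_mul, norm_inner_symm p u]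
    nlinarith [sq_nonneg (‖inner ℂ u p‖ - ‖inner ℂ u a‖), sq_nonneg (‖inner ℂ u p‖ - ‖inner ℂ u b‖)]
  rw [inner_window_conv_charVec hw hw1, norm_div, Complex.norm_two]
  have h1 : ‖inner ℂ p (charVec n w) * inner ℂ (charVec n w) (window n z + negWindow n z)‖ ≤
      ‖inner ℂ (charVec n w) p‖ ^ 2 + ‖inner ℂ (charVec n w) (window n z)‖ ^ 2 / 2
        + ‖inner ℂ (charVec n w) (negWindow n z)‖ ^ 2 / 2 := by
    refine le_trans ?_ (amgm _ _ _)
    rw [inner_add_right, mul_add]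
    exact norm_add_le _ _
  have h2 : ∀ j : Fin (n + 1), ‖skewEig (n + 1) j / (n + 1) *
          (inner ℂ p (charVec n (w * rootNegOne (n + 1) j)) *
            inner ℂ (charVec n (w * rootNegOne (n + 1) j)) (window n z - negWindow n z))‖ ≤
      skewWeight (n + 1) j * (‖inner ℂ (charVec n (w * rootNegOne (n + 1) j)) p‖ ^ 2
        + ‖inner ℂ (charVec n (w * rootNegOne (n + 1) j)) (window n z)‖ ^ 2 / 2
        + ‖inner ℂ (charVec n (w * rootNegOne (n + 1) j)) (negWindow n z)‖ ^ 2 / 2) := by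
    intro j
    have : ‖skewEig (n + 1) j / (n + 1)‖ = skewWeight (n + 1) j := by
      rw [norm_div, skewWeight]
      congr 1
      rw [← Nat.cast_succ, Complex.norm_natCast]
    rw [norm_mul, this]
    refine mul_le_mul_of_nonneg_left (le_trans ?_ (amgm _ _ _)) (skewWeight_nonneg _ _)
    rw [inner_sub_right, mul_sub]
    exact norm_sub_le _ _
  have h3 := (norm_sum_le Finset.univ (fun j : Fin (n + 1) => skewEig (n + 1) j / (n + 1) *
          (inner ℂ p (charVec n (w * rootNegOne (n + 1) j)) *
            inner ℂ (charVec n (w * rootNegOne (n + 1) j)) (window n z - negWindow n z)))).trans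
      (Finset.sum_le_sum fun j _ => h2 j)
  have h4 := norm_add_le (inner ℂ p (charVec n w) *
    inner ℂ (charVec n w) (window n z + negWindow n z))
    (∑ j : Fin (n + 1), skewEig (n + 1) j / (n + 1) *
          (inner ℂ p (charVec n (w * rootNegOne (n + 1) j)) *
            inner ℂ (charVec n (w * rootNegOne (n + 1) j)) (window n z - negWindow n z)))
  simp_rw [mul_add, Finset.sum_add_distrib, mul_div_assoc', ← Finset.sum_div] at h3
  unfold convForm
  linarith

/-! ### The discrete Fourier transform -/

/-- The frequencies of the discrete Fourier transform of size `n + 1`. -/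
def freq (n k : ℕ) : ℂ := (rootOne (n + 1))⁻¹ ^ k

lemma norm_rootOne (N : ℕ) : ‖rootOne N‖ = 1 := by
  have : rootOne N = Complex.exp (Complex.I * ((2 * Real.pi / N : ℝ) : ℂ)) := by
    rw [rootOne]; congr 1; push_cast; ring
  rw [this, Complex.norm_exp_I_mul_ofReal]

lemma norm_freq (n k : ℕ) : ‖freq n k‖ = 1 := by
  rw [freq, norm_pow, norm_inv, norm_rootOne, inv_one, one_pow]

lemma freq_pow (n k : ℕ) : freq n k ^ (n + 1) = 1 := by
  rw [freq, ← pow_mul, mul_comm, pow_mul, inv_pow,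
    (rootOne_isPrimitiveRoot (Nat.succ_ne_zero n)).pow_eq_one, inv_one, one_pow]

lemma dft_eq (z : Fin (n + 1) → ℂ) (k : Fin (n + 1)) :
    dft z k = ((1 / Real.sqrt ((n : ℝ) + 1) : ℝ) : ℂ) *
      ∑ t : Fin (n + 1), z t * rootOne (n + 1) ^ ((k : ℕ) * (t : ℕ)) := by
  rw [dft]
  congr 1
  refine Finset.sum_congr rfl fun t _ => ?_
  rw [rootOne, ← Complex.exp_nat_mul]
  congr 2
  push_cast
  ring

lemma dft_inversion (φ : Fin (n + 1) → ℂ) :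
    φ = ∑ k : Fin (n + 1), (((1 / Real.sqrt ((n : ℝ) + 1) : ℝ) : ℂ) * dft φ k) •
      (charVec n (freq n k)).ofLp := by
  have hp := rootOne_isPrimitiveRoot (Nat.succ_ne_zero n)
  have h0 : rootOne (n + 1) ≠ 0 := hp.ne_zero (Nat.succ_ne_zero n)
  have hN : ((n : ℂ) + 1) ≠ 0 := by exact_mod_cast Nat.succ_ne_zero n
  have hsq : ((1 / Real.sqrt ((n : ℝ) + 1) : ℝ) : ℂ) * ((1 / Real.sqrt ((n : ℝ) + 1) : ℝ) : ℂ)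
      = 1 / ((n : ℂ) + 1) := by
    rw [← Complex.ofReal_mul, div_mul_div_comm, Real.mul_self_sqrt (by positivity)]
    push_cast; ring
  funext t
  rw [Finset.sum_apply]
  have : ∀ k : Fin (n + 1), ((((1 / Real.sqrt ((n : ℝ) + 1) : ℝ) : ℂ) * dft φ k) •
      (charVec n (freq n k)).ofLp) t = 1 / ((n : ℂ) + 1) * ∑ s : Fin (n + 1),
        φ s * (rootOne (n + 1) ^ (((s : ℕ) : ℤ) - ((t : ℕ) : ℤ))) ^ (k : ℕ) := by
    intro k
    rw [dft_eq, ← mul_assoc, hsq, Pi.smul_apply, smul_eq_mul, mul_assoc, Finset.sum_mul]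
    congr 1
    refine Finset.sum_congr rfl fun s _ => ?_
    rw [mul_assoc]
    congr 1
    simp only [charVec, freq]
    rw [zpow_sub₀ h0, zpow_natCast, zpow_natCast, div_pow, ← pow_mul, ← pow_mul, ← pow_mul,
      inv_pow, div_eq_mul_inv, mul_comm (k : ℕ), mul_comm (k : ℕ)]
  simp_rw [this]
  rw [← Finset.mul_sum, Finset.sum_comm]
  simp_rw [← Finset.mul_sum]
  have h2 := fun s : Fin (n + 1) => sum_zpow_rootOne (N := n + 1) (Nat.succ_ne_zero n)
    (((s : ℕ) : ℤ) - ((t : ℕ) : ℤ))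
  simp_rw [h2, dvd_sub_fin_iff]
  simp only [mul_ite, mul_zero, Finset.sum_ite_eq', Finset.mem_univ, if_true]
  push_cast
  field_simp

lemma norm_charVec {u : ℂ} (hu : ‖u‖ = 1) : ‖charVec n u‖ = Real.sqrt ((n : ℝ) + 1) := by
  rw [EuclideanSpace.norm_eq]
  simp [charVec, hu]

lemma norm_toLp_le_specNorm1 (φ : Fin (n + 1) → ℂ) :
    ‖(WithLp.toLp 2 φ : EuclideanSpace ℂ (Fin (n + 1)))‖ ≤ specNorm1 φ := by
  have hs : 0 < Real.sqrt ((n : ℝ) + 1) := Real.sqrt_pos.2 (by positivity)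
  have : (WithLp.toLp 2 φ : EuclideanSpace ℂ (Fin (n + 1))) = ∑ k : Fin (n + 1),
      (((1 / Real.sqrt ((n : ℝ) + 1) : ℝ) : ℂ) * dft φ k) • charVec n (freq n k) := by
    apply (WithLp.equiv 2 _).injective
    simpa using dft_inversion φ
  rw [this]
  refine (norm_sum_le _ _).trans (Finset.sum_le_sum fun k _ => ?_)
  rw [norm_smul, norm_mul, norm_charVec (norm_freq n k), Complex.norm_real, Real.norm_of_nonneg
    (by positivity)]
  apply le_of_eq
  field_simp

lemma specNorm1_nonneg (φ : Fin (n + 1) → ℂ) : 0 ≤ specNorm1 φ :=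
  Finset.sum_nonneg fun _ _ => norm_nonneg _

lemma normSpec_nonneg (φ : Fin (n + 1) → ℂ) : 0 ≤ normSpec φ :=
  mul_nonneg (Real.sqrt_nonneg _) (specNorm1_nonneg φ)

/-- The convolution is linear in the filter. -/
def convLin (n : ℕ) (y : ℤ → ℂ) : (Fin (n + 1) → ℂ) →ₗ[ℂ] (ℤ → ℂ) where
  toFun φ := conv φ y
  map_add' φ ψ := by
    funext t; simp [conv, add_mul, Finset.sum_add_distrib]
  map_smul' c φ := by
    funext t; simp [conv, Finset.mul_sum, mul_assoc]

/-- The window as a linear map. -/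
def windowLin (n : ℕ) : (ℤ → ℂ) →ₗ[ℂ] EuclideanSpace ℂ (Fin (n + 1)) where
  toFun := window n
  map_add' _ _ := rfl
  map_smul' _ _ := rfl

/-- A linear functional of the filter is controlled on a spectral `ℓ₁` ball by its values at pure
frequencies, which replaces a supremum over filters by `n + 1` bounds. -/
lemma norm_inner_window_conv_le (z : ℤ → ℂ) (p : EuclideanSpace ℂ (Fin (n + 1))) {B : ℝ}
    (hB : ∀ k : Fin (n + 1),
      ‖inner ℂ p (window n (conv (charVec n (freq n k)) z))‖ ≤ (n + 1) * B)
    (φ : Fin (n + 1) → ℂ) :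
    ‖inner ℂ p (window n (conv φ z))‖ ≤ normSpec φ * B := by
  have hs : 0 < Real.sqrt ((n : ℝ) + 1) := Real.sqrt_pos.2 (by positivity)
  have h1 : window n (conv φ z) = ∑ k : Fin (n + 1),
      (((1 / Real.sqrt ((n : ℝ) + 1) : ℝ) : ℂ) * dft φ k) •
        window n (conv (charVec n (freq n k)) z) := by
    have := congrArg (fun ψ => windowLin n (convLin n z ψ)) (dft_inversion φ)
    simp only [map_sum, map_smul] at this
    exact this
  rw [h1, inner_sum]
  refine (norm_sum_le _ _).trans ?_
  rw [normSpec, specNorm1, Finset.mul_sum, Finset.sum_mul]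
  refine Finset.sum_le_sum fun k _ => ?_
  rw [inner_smul_right, norm_mul, norm_mul, Complex.norm_real, Real.norm_of_nonneg (by positivity)]
  calc _ ≤ 1 / Real.sqrt ((n : ℝ) + 1) * ‖dft φ k‖ * ((n + 1) * B) :=
        mul_le_mul_of_nonneg_left (hB k) (by positivity)
    _ = _ := by
        have := Real.mul_self_sqrt (show (0 : ℝ) ≤ (n : ℝ) + 1 by positivity)
        nth_rewrite 2 [← this]
        field_simp

/-! ### Existence of the estimator -/

lemma continuous_dft : Continuous (dft : (Fin (n + 1) → ℂ) → Fin (n + 1) → ℂ) := by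
  unfold dft; fun_prop

lemma continuous_penObjective (lam : ℝ) (y : ℤ → ℂ) : Continuous (penObjective n lam y) := by
  have h1 : Continuous (specNorm1 : (Fin (n + 1) → ℂ) → ℝ) := by
    unfold specNorm1
    exact continuous_finsetSum _ fun k _ => ((continuous_apply k).comp continuous_dft).norm
  have h2 : Continuous fun φ : Fin (n + 1) → ℂ => norm2 n (y - conv φ y) := by
    have : (fun φ : Fin (n + 1) → ℂ => norm2 n (y - conv φ y))
        = fun φ => ‖window n y - ((windowLin n).comp (convLin n y)) φ‖ := rfl
    rw [this]
    exact (continuous_const.sub (LinearMap.continuous_of_finiteDimensional _)).norm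
  unfold penObjective
  fun_prop

/-- For positive `lam` the penalty makes the continuous objective coercive. For `lam = 0`, which is
possible when `σ = 0`, coercivity may fail, and the minimizer comes from projecting on the range of
the convolution map. -/
theorem exists_isPenalizedFilter {lam : ℝ} (hlam : 0 ≤ lam) (y : ℤ → ℂ) :
    ∃ φ : Fin (n + 1) → ℂ, IsPenalizedFilter n lam y φ := by
  rcases hlam.eq_or_lt with rfl | hpos
  · set A := (windowLin n).comp (convLin n y)
    obtain ⟨v, hv, h⟩ := Submodule.exists_norm_eq_iInf_of_complete_subspace (LinearMap.range A)
      (Submodule.complete_of_finiteDimensional _) (window n y)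
    obtain ⟨φ, rfl⟩ := hv
    refine ⟨φ, fun ψ => ?_⟩
    have hle : ‖window n y - A φ‖ ≤ ‖window n y - A ψ‖ := by
      rw [h]
      exact ciInf_le ⟨0, by rintro _ ⟨w, rfl⟩; exact norm_nonneg _⟩
        (⟨A ψ, LinearMap.mem_range_self A ψ⟩ : LinearMap.range A)
    simp only [penObjective, zero_mul, add_zero]
    exact pow_le_pow_left₀ (norm_nonneg _) hle 2
  · refine Continuous.exists_forall_le (continuous_penObjective lam y) ?_
    have hs : 0 < Real.sqrt ((n : ℝ) + 1) := Real.sqrt_pos.2 (by positivity)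
    refine Filter.tendsto_atTop_mono (f := fun φ => lam * Real.sqrt ((n : ℝ) + 1) * ‖φ‖)
      (fun φ => ?_)
      (Filter.Tendsto.const_mul_atTop (by positivity) (tendsto_norm_cocompact_atTop))
    have h1 : ‖φ‖ ≤ specNorm1 φ := by
      refine le_trans ?_ (norm_toLp_le_specNorm1 φ)
      rw [pi_norm_le_iff_of_nonneg (norm_nonneg _)]
      exact fun i => PiLp.norm_apply_le (WithLp.toLp 2 φ : EuclideanSpace ℂ (Fin (n + 1))) i
    have := mul_le_mul_of_nonneg_left h1 (show 0 ≤ lam * Real.sqrt ((n : ℝ) + 1) by positivity)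
    unfold penObjective
    nlinarith [sq_nonneg (norm2 n (y - conv φ y))]

end

section

/-! ### Deviation bounds -/

/-! ### From exponential moments to tails. -/

section Tail

variable {Ω : Type*} [MeasurableSpace Ω] {μ : Measure Ω}

lemma measure_lt_le_of_lintegral_exp_le {V : Ω → ℝ} (hV : AEMeasurable V μ) {m δ : ℝ} (hδ : 0 < δ)
    (h : ∫⁻ ω, ENNReal.ofReal (Real.exp (V ω)) ∂μ ≤ ENNReal.ofReal (Real.exp m)) :
    μ {ω | m + Real.log (1 / δ) < V ω} ≤ ENNReal.ofReal δ := by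
  set c := Real.exp (m + Real.log (1 / δ)) with hc
  have hc0 : 0 < c := Real.exp_pos _
  calc μ {ω | m + Real.log (1 / δ) < V ω}
      ≤ μ {ω | ENNReal.ofReal c ≤ ENNReal.ofReal (Real.exp (V ω))} :=
        measure_mono fun ω hω => ENNReal.ofReal_le_ofReal (Real.exp_le_exp.2 (le_of_lt hω))
    _ ≤ (∫⁻ ω, ENNReal.ofReal (Real.exp (V ω)) ∂μ) / ENNReal.ofReal c :=
        meas_ge_le_lintegral_div (by fun_prop) (by simpa using hc0) ENNReal.ofReal_ne_top
    _ ≤ ENNReal.ofReal (Real.exp m) / ENNReal.ofReal c := ENNReal.div_le_div_right h _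
    _ = ENNReal.ofReal δ := by
        rw [← ENNReal.ofReal_div_of_pos hc0, hc, Real.exp_add, Real.exp_log (by positivity)]
        congr 1
        field_simp

/-- Jensen's inequality for `exp`: averages of arbitrarily dependent variables inherit the moment
bound. -/
lemma lintegral_exp_average_le {T : Type*} [Fintype T] [Nonempty T] {V : T → Ω → ℝ}
    (hV : ∀ t, AEMeasurable (V t) μ) {c : ℝ≥0∞}
    (h : ∀ t, ∫⁻ ω, ENNReal.ofReal (Real.exp (V t ω)) ∂μ ≤ c) :
    ∫⁻ ω, ENNReal.ofReal (Real.exp ((∑ t, V t ω) / Fintype.card T)) ∂μ ≤ c := by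
  have hT : (0 : ℝ) < Fintype.card T := by exact_mod_cast Fintype.card_pos
  set q : ℝ := (Fintype.card T : ℝ)⁻¹ with hq
  have hq0 : 0 < q := inv_pos.2 hT
  have hsum : ∑ _t : T, q = 1 := by
    rw [Finset.sum_const, Finset.card_univ, nsmul_eq_mul, hq]; field_simp
  calc ∫⁻ ω, ENNReal.ofReal (Real.exp ((∑ t, V t ω) / Fintype.card T)) ∂μ
      ≤ ∫⁻ ω, ∑ t, ENNReal.ofReal q * ENNReal.ofReal (Real.exp (V t ω)) ∂μ := by
        refine lintegral_mono fun ω => ?_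
        have := convexOn_exp.map_sum_le (t := Finset.univ) (w := fun _ : T => q)
          (p := fun t => V t ω) (fun _ _ => hq0.le) hsum (fun _ _ => Set.mem_univ _)
        simp only [smul_eq_mul] at this
        rw [← Finset.mul_sum, hq, inv_mul_eq_div, ← hq] at this
        refine (ENNReal.ofReal_le_ofReal this).trans (le_of_eq ?_)
        rw [ENNReal.ofReal_sum_of_nonneg fun _ _ => by positivity]
        exact Finset.sum_congr rfl fun t _ => ENNReal.ofReal_mul hq0.le
    _ = ∑ t, ENNReal.ofReal q * ∫⁻ ω, ENNReal.ofReal (Real.exp (V t ω)) ∂μ := by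
        rw [lintegral_finsetSum' _ fun t _ => by have := hV t; fun_prop]
        refine Finset.sum_congr rfl fun t _ => ?_
        rw [lintegral_const_mul'' _ (by have := hV t; fun_prop)]
    _ ≤ ∑ _t : T, ENNReal.ofReal q * c := Finset.sum_le_sum fun t _ => by gcongr; exact h t
    _ = c := by
        rw [← Finset.sum_mul, ← ENNReal.ofReal_sum_of_nonneg fun _ _ => hq0.le, hsum]; simp

end Tail

/-! ### Linear functionals and projections of Gaussian vectors. -/

section Gaussian

variable {Ω : Type*} [MeasurableSpace Ω] {μ : Measure Ω} {ι : Type*} [Fintype ι]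

/-- A Euclidean vector of independent standard complex Gaussians. -/
def IsGaussianVector (μ : Measure Ω) (ξ : Ω → EuclideanSpace ℂ ι) : Prop :=
  HasLaw (fun ω => (ξ ω).ofLp) (piGaussian ι) μ

lemma IsGaussianVector.lintegral_comp {ξ : Ω → EuclideanSpace ℂ ι} (hξ : IsGaussianVector μ ξ)
    {f : EuclideanSpace ℂ ι → ℝ≥0∞} (hf : Measurable fun z : ι → ℂ => f (WithLp.toLp 2 z)) :
    ∫⁻ ω, f (ξ ω) ∂μ = ∫⁻ z, f (WithLp.toLp 2 z) ∂piGaussian ι := by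
  rw [← hξ.map_eq, lintegral_map' hf.aemeasurable hξ.aemeasurable]

lemma IsGaussianVector.aemeasurable_comp {ξ : Ω → EuclideanSpace ℂ ι}
    (hξ : IsGaussianVector μ ξ) {f : EuclideanSpace ℂ ι → ℝ} (hf : Continuous f) :
    AEMeasurable (fun ω => f (ξ ω)) μ := by
  have h : Measurable fun z : ι → ℂ => f (WithLp.toLp 2 z) :=
    (hf.comp (PiLp.continuous_toLp 2 _)).measurable
  exact h.comp_aemeasurable hξ.aemeasurable

lemma IsGaussianVector.lintegral_exp_sum_le {ξ : Ω → EuclideanSpace ℂ ι}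
    (hξ : IsGaussianVector μ ξ) {J : Type*} [Fintype J] (u : J → EuclideanSpace ℂ ι) (θ : J → ℝ)
    (h0 : ∀ j, 0 ≤ θ j) (h1 : ∀ j, θ j ≤ 1 / 2)
    (hu : ∀ g : J → ℂ, ‖∑ j, g j • u j‖ ^ 2 ≤ ∑ j, θ j * ‖g j‖ ^ 2) :
    ∫⁻ ω, ENNReal.ofReal (Real.exp ((∑ j, ‖inner ℂ (u j) (ξ ω)‖ ^ 2) / 2)) ∂μ
      ≤ ENNReal.ofReal (Real.exp (2 * ∑ j, θ j)) := by
  refine le_trans (le_of_eq ?_) (lintegral_exp_sum_normSq_inner_le u θ h0 h1 hu)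
  refine hξ.lintegral_comp (f := fun x =>
    ENNReal.ofReal (Real.exp ((∑ j, ‖inner ℂ (u j) x‖ ^ 2) / 2))) ?_
  refine ENNReal.measurable_ofReal.comp (Real.measurable_exp.comp (Continuous.measurable ?_))
  fun_prop

lemma IsGaussianVector.lintegral_exp_normSq_inner_le {ξ : Ω → EuclideanSpace ℂ ι}
    (hξ : IsGaussianVector μ ξ) {u : EuclideanSpace ℂ ι} (hu : ‖u‖ ≤ 1) :
    ∫⁻ ω, ENNReal.ofReal (Real.exp (‖inner ℂ u (ξ ω)‖ ^ 2 / 4)) ∂μ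
      ≤ ENNReal.ofReal (Real.exp 1) := by
  have h2 : (((Real.sqrt 2)⁻¹ : ℝ)) ^ 2 = 1 / 2 := by rw [inv_pow, Real.sq_sqrt] <;> norm_num
  have := hξ.lintegral_exp_sum_le (J := Unit) (fun _ => (((Real.sqrt 2)⁻¹ : ℝ) : ℂ) • u)
    (fun _ => 1 / 2) (fun _ => by norm_num) (fun _ => le_rfl) (fun g => by
      simp only [Finset.univ_unique, Finset.sum_singleton, norm_smul, mul_pow, Complex.norm_real,
        Real.norm_eq_abs, sq_abs, h2]
      have : ‖u‖ ^ 2 ≤ 1 := pow_le_one₀ (norm_nonneg _) hu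
      nlinarith [mul_le_mul_of_nonneg_left this (sq_nonneg ‖g default‖)])
  simp only [Finset.univ_unique, Finset.sum_singleton, inner_smul_left, norm_mul, mul_pow,
    RCLike.norm_conj, Complex.norm_real, Real.norm_eq_abs, sq_abs, h2] at this
  convert this using 5
  · ring
  · norm_num

/-- The vectors `ξ t` may be overlapping shifts of one noise, so the terms are averaged by Jensen
rather than treated as independent. -/
lemma measure_sum_normSq_inner_le {T : Type*} [Fintype T] [Nonempty T]
    {ξ : T → Ω → EuclideanSpace ℂ ι} (hξ : ∀ t, IsGaussianVector μ (ξ t))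
    (u : T → EuclideanSpace ℂ ι) {D : ℝ} (hu : ∀ t, ‖u t‖ ≤ D) {δ : ℝ} (hδ : 0 < δ) :
    μ {ω | Fintype.card T * D ^ 2 * (4 * (1 + Real.log (1 / δ))) <
      ∑ t, ‖inner ℂ (u t) (ξ t ω)‖ ^ 2} ≤ ENNReal.ofReal δ := by
  have hT : (0 : ℝ) < Fintype.card T := by exact_mod_cast Fintype.card_pos
  have hD : 0 ≤ D := (norm_nonneg _).trans (hu (Classical.arbitrary T))
  rcases hD.eq_or_lt with rfl | hD
  · have : ∀ t, u t = 0 := fun t => norm_le_zero_iff.1 (hu t)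
    simp [this]
  have hm : ∀ t, AEMeasurable (fun ω => ‖inner ℂ (((D⁻¹ : ℝ) : ℂ) • u t) (ξ t ω)‖ ^ 2 / 4) μ :=
    fun t => (hξ t).aemeasurable_comp
      (f := fun x => ‖inner ℂ (((D⁻¹ : ℝ) : ℂ) • u t) x‖ ^ 2 / 4) (by fun_prop)
  have h1 := lintegral_exp_average_le hm (fun t => (hξ t).lintegral_exp_normSq_inner_le (by
    rw [norm_smul, Complex.norm_real, Real.norm_of_nonneg (by positivity),
      inv_mul_le_iff₀ hD, mul_one]
    exact hu t))
  refine le_trans (measure_mono fun ω hω => ?_) (measure_lt_le_of_lintegral_exp_le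
    (AEMeasurable.div_const (Finset.aemeasurable_fun_sum _ fun t _ => hm t) _) hδ h1)
  simp only [Set.mem_ofPred_eq] at hω ⊢
  have e : ∀ t, ‖inner ℂ (((D⁻¹ : ℝ) : ℂ) • u t) (ξ t ω)‖ ^ 2 / 4
      = ‖inner ℂ (u t) (ξ t ω)‖ ^ 2 / (4 * D ^ 2) := by
    intro t
    rw [inner_smul_left, norm_mul, RCLike.norm_conj, Complex.norm_real,
      Real.norm_of_nonneg (by positivity), mul_pow]
    field_simp
  simp_rw [e, ← Finset.sum_div]
  rw [lt_div_iff₀ hT, lt_div_iff₀ (by positivity)]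
  calc _ = Fintype.card T * D ^ 2 * (4 * (1 + Real.log (1 / δ))) := by ring
    _ < _ := hω

lemma measure_norm_starProjection_le {ξ : Ω → EuclideanSpace ℂ ι} (hξ : IsGaussianVector μ ξ)
    (K : Submodule ℂ (EuclideanSpace ℂ ι)) {δ : ℝ} (hδ : 0 < δ) :
    μ {ω | 4 * (Module.finrank ℂ K + Real.log (1 / δ)) < ‖K.starProjection (ξ ω)‖ ^ 2}
      ≤ ENNReal.ofReal δ := by
  have h2 : (((Real.sqrt 2)⁻¹ : ℝ)) ^ 2 = 1 / 2 := by rw [inv_pow, Real.sq_sqrt] <;> norm_num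
  set b := stdOrthonormalBasis ℂ K
  have hb : ∀ x, ‖K.starProjection x‖ ^ 2 = ∑ i, ‖inner ℂ (b i : EuclideanSpace ℂ ι) x‖ ^ 2 := by
    intro x
    rw [Submodule.starProjection_apply, ← Submodule.coe_norm, ← b.sum_sq_norm_inner_right]
    refine Finset.sum_congr rfl fun i _ => ?_
    rw [Submodule.coe_inner, Submodule.coe_orthogonalProjectionOnto_apply,
      ← Submodule.inner_starProjection_left_eq_right,
      Submodule.starProjection_eq_self_iff.2 (b i).2]
  have hmgf := hξ.lintegral_exp_sum_le
    (fun i => (((Real.sqrt 2)⁻¹ : ℝ) : ℂ) • (b i : EuclideanSpace ℂ ι))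
    (fun _ => 1 / 2) (fun _ => by norm_num) (fun _ => le_rfl) (fun g => by
      have e : ∑ j, g j • (((Real.sqrt 2)⁻¹ : ℝ) : ℂ) • (b j : EuclideanSpace ℂ ι)
        = (((Real.sqrt 2)⁻¹ : ℝ) : ℂ) • ((∑ j, g j • b j : K) : EuclideanSpace ℂ ι) := by
        push_cast
        rw [Finset.smul_sum]
        exact Finset.sum_congr rfl fun j _ => smul_comm _ _ _
      rw [e, norm_smul, mul_pow, Complex.norm_real, Real.norm_eq_abs, sq_abs, h2,
        ← Submodule.coe_norm, ← b.sum_sq_norm_inner_right, Finset.mul_sum]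
      refine Finset.sum_le_sum fun j _ => ?_
      rw [b.orthonormal.inner_right_fintype])
  have e : ∀ ω, (∑ j, ‖inner ℂ ((((Real.sqrt 2)⁻¹ : ℝ) : ℂ) • (b j : EuclideanSpace ℂ ι))
      (ξ ω)‖ ^ 2) / 2 = ‖K.starProjection (ξ ω)‖ ^ 2 / 4 := by
    intro ω
    rw [hb, Finset.sum_div, Finset.sum_div]
    refine Finset.sum_congr rfl fun i _ => ?_
    rw [inner_smul_left, norm_mul, RCLike.norm_conj, Complex.norm_real, mul_pow, Real.norm_eq_abs,
      sq_abs, h2]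
    ring
  simp_rw [e] at hmgf
  rw [Finset.sum_const, Finset.card_univ, Fintype.card_fin, nsmul_eq_mul,
    show 2 * ((Module.finrank ℂ K : ℝ) * (1 / 2)) = Module.finrank ℂ K by ring] at hmgf
  refine le_trans (measure_mono fun ω hω => ?_) (measure_lt_le_of_lintegral_exp_le
    (hξ.aemeasurable_comp (f := fun x => ‖K.starProjection x‖ ^ 2 / 4) (by fun_prop)) hδ hmgf)
  simp only [Set.mem_ofPred_eq] at hω ⊢
  linarith

end Gaussian

/-! ### Tails of the convolution form. -/

section ConvForm

variable {Ω : Type*} [MeasurableSpace Ω] {μ : Measure Ω} {n : ℕ}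

lemma norm_sq_sum_smul_charVec {w : ℂ} (hw : ‖w‖ = 1) (g : Fin (n + 1) → ℂ) :
    ‖∑ j : Fin (n + 1), g j • charVec n (w * rootNegOne (n + 1) j)‖ ^ 2
      = (n + 1) * ∑ j, ‖g j‖ ^ 2 := by
  have hnorm : ∀ j : Fin (n + 1), ‖w * rootNegOne (n + 1) j‖ = 1 := fun j => by
    rw [norm_mul, hw, norm_rootNegOne, one_mul]
  have hw0 : w ≠ 0 := by rintro rfl; simp at hw
  have h0 : rootOne (n + 1) ≠ 0 :=
    (rootOne_isPrimitiveRoot (Nat.succ_ne_zero n)).ne_zero (Nat.succ_ne_zero n)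
  have hin : ∀ j l : Fin (n + 1), inner ℂ (charVec n (w * rootNegOne (n + 1) j))
      (charVec n (w * rootNegOne (n + 1) l)) = if l = j then ((n : ℂ) + 1) else 0 := by
    intro j l
    rw [inner_charVec (hnorm j)]
    have := sum_zpow_rootOne (N := n + 1) (Nat.succ_ne_zero n) (((l : ℕ) : ℤ) - ((j : ℕ) : ℤ))
    simp_rw [dvd_sub_fin_iff] at this
    push_cast at this
    rw [← this]
    refine Finset.sum_congr rfl fun t _ => ?_
    simp only [charVec]
    rw [← mul_pow]
    congr 1
    rw [zpow_sub₀ h0, zpow_natCast, zpow_natCast, rootNegOne_eq (n + 1) j, rootNegOne_eq (n + 1) l]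
    have h1 := rootNegOne_ne_zero (n + 1) 0
    have h2 : rootOne (n + 1) ^ (j : ℕ) ≠ 0 := pow_ne_zero _ h0
    field_simp
  have hre := norm_sq_eq_re_inner (𝕜 := ℂ)
    (∑ j : Fin (n + 1), g j • charVec n (w * rootNegOne (n + 1) j))
  rw [hre, sum_inner]
  simp_rw [inner_sum, inner_smul_left, inner_smul_right, hin]
  simp only [mul_ite, mul_zero, Finset.sum_ite_eq', Finset.mem_univ, if_true]
  rw [map_sum, Finset.mul_sum]
  refine Finset.sum_congr rfl fun j _ => ?_
  rw [← mul_assoc, Complex.conj_mul']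
  rw [← Complex.ofReal_pow, ← Nat.cast_succ, ← Complex.ofReal_natCast, ← Complex.ofReal_mul]
  rw [RCLike.re_eq_complex_re, Complex.ofReal_re]
  push_cast
  ring

/-- The rank-one part and the weighted part are dependent; each is normalized by `4 (n + 1)` and
Jensen over `Bool` doubles this to `8 (n + 1)`. Projecting costs nothing, since it is self-adjoint
and contracts the test vectors. -/
lemma measure_convForm_le {ξ : Ω → EuclideanSpace ℂ (Fin (n + 1))} (hξ : IsGaussianVector μ ξ)
    (K : Submodule ℂ (EuclideanSpace ℂ (Fin (n + 1)))) {w : ℂ} (hw : ‖w‖ = 1) {δ : ℝ}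
    (hδ : 0 < δ) :
    μ {ω | 8 * (n + 1) * (2 + 2 * Real.log (n + 1) + Real.log (1 / δ)) <
      convForm n w (K.starProjection (ξ ω))} ≤ ENNReal.ofReal δ := by
  have hN : (0 : ℝ) < n + 1 := by positivity
  have hlog : 0 ≤ Real.log (n + 1) := Real.log_nonneg (by simp)
  set V : Bool → Ω → ℝ := fun b ω => bif b then
      ‖inner ℂ (charVec n w) (K.starProjection (ξ ω))‖ ^ 2 / (4 * (n + 1))
    else (∑ j : Fin (n + 1), skewWeight (n + 1) j *
      ‖inner ℂ (charVec n (w * rootNegOne (n + 1) j)) (K.starProjection (ξ ω))‖ ^ 2) /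
        (4 * (n + 1)) with hVdef
  have hm : ∀ b, AEMeasurable (V b) μ := by
    intro b
    cases b
    · exact hξ.aemeasurable_comp (f := fun x => (∑ j : Fin (n + 1), skewWeight (n + 1) j *
        ‖inner ℂ (charVec n (w * rootNegOne (n + 1) j)) (K.starProjection x)‖ ^ 2) /
        (4 * (n + 1))) (by fun_prop)
    · exact hξ.aemeasurable_comp (f := fun x =>
        ‖inner ℂ (charVec n w) (K.starProjection x)‖ ^ 2 / (4 * (n + 1))) (by fun_prop)
  have hV : ∀ b, ∫⁻ ω, ENNReal.ofReal (Real.exp (V b ω)) ∂μ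
      ≤ ENNReal.ofReal (Real.exp (2 + 2 * Real.log (n + 1))) := by
    intro b
    cases b
    · have h := hξ.lintegral_exp_sum_le
        -- The characters are orthogonal with squared norm `n + 1`, so this scaling gives `θ j =
        -- skewWeight / 2 ≤ 1/2`.
        (fun j : Fin (n + 1) => ((Real.sqrt (skewWeight (n + 1) j / (2 * (n + 1))) : ℝ) : ℂ) •
          K.starProjection (charVec n (w * rootNegOne (n + 1) j)))
        (fun j => skewWeight (n + 1) j / 2)
        (fun j => div_nonneg (skewWeight_nonneg _ _) (by norm_num))
        (fun j => div_le_div_of_nonneg_right (skewWeight_le_one _ _) (by norm_num))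
        (fun g => by
          have e : ∑ j : Fin (n + 1), g j •
              ((Real.sqrt (skewWeight (n + 1) j / (2 * (n + 1))) : ℝ) : ℂ) •
                K.starProjection (charVec n (w * rootNegOne (n + 1) j))
              = K.starProjection (∑ j : Fin (n + 1),
                (g j * ((Real.sqrt (skewWeight (n + 1) j / (2 * (n + 1))) : ℝ) : ℂ)) •
                  charVec n (w * rootNegOne (n + 1) j)) := by
            rw [map_sum]
            refine Finset.sum_congr rfl fun j _ => ?_
            rw [map_smul, smul_smul]
          rw [e]
          refine (pow_le_pow_left₀ (norm_nonneg _)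
            (Submodule.norm_starProjection_apply_le _ _) 2).trans (le_of_eq ?_)
          rw [norm_sq_sum_smul_charVec hw, Finset.mul_sum]
          refine Finset.sum_congr rfl fun j _ => ?_
          rw [norm_mul, mul_pow, Complex.norm_real, Real.norm_eq_abs, sq_abs,
            Real.sq_sqrt (div_nonneg (skewWeight_nonneg _ _) (by positivity))]
          field_simp)
      have e : ∀ ω, (∑ j : Fin (n + 1),
          ‖inner ℂ (((Real.sqrt (skewWeight (n + 1) j / (2 * (n + 1))) : ℝ) : ℂ) •
          K.starProjection (charVec n (w * rootNegOne (n + 1) j))) (ξ ω)‖ ^ 2) / 2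
          = V false ω := by
        intro ω
        simp only [hVdef, cond_false]
        rw [Finset.sum_div, Finset.sum_div]
        refine Finset.sum_congr rfl fun j _ => ?_
        rw [inner_smul_left, norm_mul, mul_pow, RCLike.norm_conj, Complex.norm_real,
          Real.norm_eq_abs, sq_abs,
          Real.sq_sqrt (div_nonneg (skewWeight_nonneg _ _) (by positivity)),
          Submodule.inner_starProjection_left_eq_right]
        field_simp
        ring
      simp_rw [e] at h
      refine h.trans (ENNReal.ofReal_le_ofReal (Real.exp_le_exp.2 ?_))
      have := sum_skewWeight_le (N := n + 1) (Nat.succ_ne_zero n)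
      push_cast at this
      rw [← Finset.sum_div]
      linarith
    · have h := hξ.lintegral_exp_normSq_inner_le
        (u := (((Real.sqrt ((n : ℝ) + 1))⁻¹ : ℝ) : ℂ) • K.starProjection (charVec n w)) (by
          rw [norm_smul, Complex.norm_real, Real.norm_of_nonneg (by positivity),
            inv_mul_le_iff₀ (Real.sqrt_pos.2 hN), mul_one, ← norm_charVec hw]
          exact Submodule.norm_starProjection_apply_le _ _)
      have e : ∀ ω, ‖inner ℂ ((((Real.sqrt ((n : ℝ) + 1))⁻¹ : ℝ) : ℂ) •
          K.starProjection (charVec n w)) (ξ ω)‖ ^ 2 / 4 = V true ω := by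
        intro ω
        simp only [hVdef, cond_true]
        rw [inner_smul_left, norm_mul, mul_pow, RCLike.norm_conj, Complex.norm_real,
          Real.norm_eq_abs, sq_abs, inv_pow, Real.sq_sqrt hN.le,
          Submodule.inner_starProjection_left_eq_right]
        field_simp
      simp_rw [e] at h
      exact h.trans (ENNReal.ofReal_le_ofReal (Real.exp_le_exp.2 (by linarith)))
  have h1 := lintegral_exp_average_le hm hV
  refine le_trans (measure_mono fun ω hω => ?_) (measure_lt_le_of_lintegral_exp_le
    (AEMeasurable.div_const (Finset.aemeasurable_fun_sum _ fun t _ => hm t) _) hδ h1)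
  simp only [Set.mem_ofPred_eq, convForm] at hω ⊢
  simp only [Fintype.univ_bool, Finset.mem_singleton, Bool.true_eq_false, not_false_eq_true,
    Finset.sum_insert, Finset.sum_singleton, Fintype.card_bool, hVdef, cond_true, cond_false]
  rw [← add_div, div_div, lt_div_iff₀ (by positivity)]
  push_cast
  linarith

end ConvForm

end

section

/-! ### The favourable event -/

variable {n : ℕ}

/-- The deterministic conditions on a noise realization under which the oracle inequality holds. -/
structure GoodNoise (n : ℕ) (K : Submodule ℂ (EuclideanSpace ℂ (Fin (n + 1))))
    (v : EuclideanSpace ℂ (Fin (n + 1))) (φ : Fin (n + 1) → ℂ)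
    (e : Fin (n + 1) → EuclideanSpace ℂ (Fin (n + 1))) (D α : ℝ) (z : ℤ → ℂ) : Prop where
  bias_le : ‖inner ℂ v (window n z)‖ ^ 2 ≤ ‖v‖ ^ 2 * (4 * (1 + Real.log (10 / α)))
  conv_le : norm2 n (conv φ z) ^ 2 ≤
    (n + 1) * ‖(WithLp.toLp 2 φ : EuclideanSpace ℂ (Fin (n + 1)))‖ ^ 2 *
      (4 * (1 + Real.log (10 / α)))
  proj_le : ‖K.starProjection (window n z)‖ ^ 2 ≤ 4 * (Module.finrank ℂ K + Real.log (10 / α))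
  err_le : ‖inner ℂ (e 0) (window n z)‖ ^ 2 ≤ D ^ 2 * (4 * (1 + Real.log (10 / α)))
  errs_le : ∑ τ, ‖inner ℂ (e τ) (window n z)‖ ^ 2 ≤
    (n + 1) * D ^ 2 * (4 * (1 + Real.log (10 / α)))
  form_perp_le : ∀ k : Fin (n + 1), convForm n (freq n k) (Kᗮ.starProjection (window n z)) ≤
    8 * (n + 1) * (2 + 2 * Real.log (n + 1) + Real.log (6 * (n + 1) / α))
  form_pos_le : ∀ k : Fin (n + 1), convForm n (freq n k) (window n z) ≤
    8 * (n + 1) * (2 + 2 * Real.log (n + 1) + Real.log (6 * (n + 1) / α))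
  form_neg_le : ∀ k : Fin (n + 1), convForm n (freq n k) (negWindow n z) ≤
    8 * (n + 1) * (2 + 2 * Real.log (n + 1) + Real.log (6 * (n + 1) / α))

section

variable {Ω : Type*} [MeasurableSpace Ω] {μ : Measure Ω}

lemma IsStdNoise.isGaussianVector {ζ : ℤ → Ω → ℂ} (h : IsStdNoise μ n ζ) {ι : Type*} [Fintype ι]
    {idx : ι → ℤ} (hinj : Function.Injective idx)
    (hmem : ∀ i, idx i ∈ Set.Icc (-(n : ℤ)) (n : ℤ)) :
    IsGaussianVector μ (fun ω => (WithLp.toLp 2 fun i => ζ (idx i) ω : EuclideanSpace ℂ ι)) := by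
  have hi := h.1.precomp (g := fun i => (⟨idx i, hmem i⟩ : Set.Icc (-(n : ℤ)) (n : ℤ)))
    (fun i j hij => hinj (congrArg Subtype.val hij))
  exact hi.hasLaw_pi fun i => h.2 ⟨idx i, hmem i⟩

theorem exists_measurableSet_goodNoise [IsProbabilityMeasure μ] {ζ : ℤ → Ω → ℂ}
    (h : IsStdNoise μ n ζ) (K : Submodule ℂ (EuclideanSpace ℂ (Fin (n + 1))))
    (v : EuclideanSpace ℂ (Fin (n + 1))) (φ : Fin (n + 1) → ℂ)
    (e : Fin (n + 1) → EuclideanSpace ℂ (Fin (n + 1))) {D : ℝ} (he : ∀ τ, ‖e τ‖ ≤ D) {α : ℝ}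
    (hα : 0 < α) :
    ∃ Ξ : Set Ω, MeasurableSet Ξ ∧ 1 - α ≤ μ.real Ξ ∧
      ∀ ω ∈ Ξ, GoodNoise n K v φ e D α (fun τ => ζ τ ω) := by
  have hpos : IsGaussianVector μ (fun ω => window n fun τ => ζ τ ω) :=
    h.isGaussianVector (idx := fun t : Fin (n + 1) => ((t : ℕ) : ℤ))
      (fun i j hij => Fin.ext (by simp only at hij; omega))
      (fun i => by have := i.2; simp only [Set.mem_Icc]; omega)
  have hneg : IsGaussianVector μ (fun ω => negWindow n fun τ => ζ τ ω) := by
    refine h.isGaussianVector (idx := negIndex) (fun i j hij => ?_) (fun i => ?_)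
    · have hi := i.2
      have hj := j.2
      simp only [negIndex] at hij
      split_ifs at hij with h1 h2 h2
      · rw [h1, h2]
      · omega
      · omega
      · ext; omega
    · have hi := i.2
      simp only [negIndex, Set.mem_Icc]
      split_ifs with h1
      · omega
      · have : (i : ℕ) ≠ 0 := fun h' => h1 (Fin.ext h')
        omega
  have hshift : ∀ t : Fin (n + 1), IsGaussianVector μ (fun ω =>
      (WithLp.toLp 2 fun τ : Fin (n + 1) => ζ (((t : ℕ) : ℤ) - ((τ : ℕ) : ℤ)) ω :
        EuclideanSpace ℂ (Fin (n + 1)))) := fun t =>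
    h.isGaussianVector (idx := fun τ : Fin (n + 1) => ((t : ℕ) : ℤ) - ((τ : ℕ) : ℤ))
      (fun i j hij => Fin.ext (by simp only at hij; omega))
      (fun i => by have := i.2; have := t.2; simp only [Set.mem_Icc]; omega)
  -- Probability budget: five events at `α / 10` and three families of `n + 1` events at `α / (6 (n
  -- + 1))` add up to `α`.
  have hδ : 0 < α / 10 := by positivity
  have hδ' : 0 < α / (6 * (n + 1)) := by positivity
  set B1 := {ω | Fintype.card Unit * ‖v‖ ^ 2 * (4 * (1 + Real.log (1 / (α / 10)))) <
    ∑ _t : Unit, ‖inner ℂ v (window n fun τ => ζ τ ω)‖ ^ 2} with hB1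
  have m1 : μ B1 ≤ ENNReal.ofReal (α / 10) :=
    measure_sum_normSq_inner_le (T := Unit) (fun _ => hpos) (fun _ => v) (fun _ => le_rfl) hδ
  -- Conjugated, so that pairing `u` with a reversed, shifted window of the noise gives `φ * ζ` at
  -- time `t`.
  set u : EuclideanSpace ℂ (Fin (n + 1)) := WithLp.toLp 2 fun τ => star (φ τ) with hu
  have hnu : ‖u‖ = ‖(WithLp.toLp 2 φ : EuclideanSpace ℂ (Fin (n + 1)))‖ := by
    rw [EuclideanSpace.norm_eq, EuclideanSpace.norm_eq]
    simp [hu]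
  set B2 := {ω | Fintype.card (Fin (n + 1)) * ‖u‖ ^ 2 * (4 * (1 + Real.log (1 / (α / 10)))) <
    ∑ t : Fin (n + 1), ‖inner ℂ u
      (WithLp.toLp 2 fun τ : Fin (n + 1) => ζ (((t : ℕ) : ℤ) - ((τ : ℕ) : ℤ)) ω :
        EuclideanSpace ℂ (Fin (n + 1)))‖ ^ 2} with hB2
  have m2 : μ B2 ≤ ENNReal.ofReal (α / 10) :=
    measure_sum_normSq_inner_le hshift (fun _ => u) (fun _ => le_rfl) hδ
  set B3 := {ω | 4 * (Module.finrank ℂ K + Real.log (1 / (α / 10))) <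
    ‖K.starProjection (window n fun τ => ζ τ ω)‖ ^ 2} with hB3
  have m3 : μ B3 ≤ ENNReal.ofReal (α / 10) := measure_norm_starProjection_le hpos K hδ
  set B4 := {ω | Fintype.card Unit * D ^ 2 * (4 * (1 + Real.log (1 / (α / 10)))) <
    ∑ _t : Unit, ‖inner ℂ (e 0) (window n fun τ => ζ τ ω)‖ ^ 2} with hB4
  have m4 : μ B4 ≤ ENNReal.ofReal (α / 10) :=
    measure_sum_normSq_inner_le (T := Unit) (fun _ => hpos) (fun _ => e 0) (fun _ => he 0) hδ
  set B5 := {ω | Fintype.card (Fin (n + 1)) * D ^ 2 * (4 * (1 + Real.log (1 / (α / 10)))) <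
    ∑ τ, ‖inner ℂ (e τ) (window n fun τ => ζ τ ω)‖ ^ 2} with hB5
  have m5 : μ B5 ≤ ENNReal.ofReal (α / 10) :=
    measure_sum_normSq_inner_le (fun _ => hpos) e he hδ
  set A := fun (L : Submodule ℂ (EuclideanSpace ℂ (Fin (n + 1))))
    (ξ : Ω → EuclideanSpace ℂ (Fin (n + 1))) =>
    ⋃ k : Fin (n + 1), {ω | 8 * (n + 1) * (2 + 2 * Real.log (n + 1) +
      Real.log (1 / (α / (6 * (n + 1))))) < convForm n (freq n k) (L.starProjection (ξ ω))} with hA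
  have mA : ∀ L ξ, IsGaussianVector μ ξ → μ (A L ξ) ≤ ENNReal.ofReal (α / 6) := by
    intro L ξ hξ
    refine (measure_iUnion_fintype_le μ _).trans ((Finset.sum_le_sum fun (k : Fin (n + 1)) _ =>
      measure_convForm_le hξ L (norm_freq n k) hδ').trans (le_of_eq ?_))
    rw [← ENNReal.ofReal_sum_of_nonneg fun _ _ => hδ'.le, Finset.sum_const, Finset.card_univ,
      Fintype.card_fin, nsmul_eq_mul]
    congr 1
    push_cast
    field_simp
  set Bad : Set Ω := B1 ∪ B2 ∪ B3 ∪ B4 ∪ B5 ∪ A Kᗮ (fun ω => window n fun τ => ζ τ ω)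
    ∪ A ⊤ (fun ω => window n fun τ => ζ τ ω) ∪ A ⊤ (fun ω => negWindow n fun τ => ζ τ ω) with hBad
  have hmeas : μ Bad ≤ ENNReal.ofReal α := by
    have e : ENNReal.ofReal α = ENNReal.ofReal (α / 10) + ENNReal.ofReal (α / 10)
        + ENNReal.ofReal (α / 10) + ENNReal.ofReal (α / 10) + ENNReal.ofReal (α / 10)
        + ENNReal.ofReal (α / 6) + ENNReal.ofReal (α / 6) + ENNReal.ofReal (α / 6) := by
      rw [← ENNReal.ofReal_add, ← ENNReal.ofReal_add, ← ENNReal.ofReal_add, ← ENNReal.ofReal_add,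
        ← ENNReal.ofReal_add, ← ENNReal.ofReal_add, ← ENNReal.ofReal_add]
      · congr 1; ring
      all_goals positivity
    rw [e]
    refine (measure_union_le _ _).trans (add_le_add ?_ (mA _ _ hneg))
    refine (measure_union_le _ _).trans (add_le_add ?_ (mA _ _ hpos))
    refine (measure_union_le _ _).trans (add_le_add ?_ (mA _ _ hpos))
    refine (measure_union_le _ _).trans (add_le_add ?_ m5)
    refine (measure_union_le _ _).trans (add_le_add ?_ m4)
    refine (measure_union_le _ _).trans (add_le_add ?_ m3)
    exact (measure_union_le _ _).trans (add_le_add m1 m2)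
  -- The noise is only almost everywhere measurable, so `Bad` is replaced by its measurable hull.
  refine ⟨(toMeasurable μ Bad)ᶜ, (measurableSet_toMeasurable μ Bad).compl, ?_, fun ω hω => ?_⟩
  · rw [probReal_compl_eq_one_sub (measurableSet_toMeasurable μ Bad), measureReal_def,
      measure_toMeasurable]
    have := ENNReal.toReal_le_of_le_ofReal hα.le hmeas
    linarith
  · have hω' : ω ∉ Bad := fun hb => hω (subset_toMeasurable μ Bad hb)
    simp only [hBad, Set.mem_union, not_or] at hω'
    obtain ⟨⟨⟨⟨⟨⟨⟨h1, h2⟩, h3⟩, h4⟩, h5⟩, h6⟩, h7⟩, h8⟩ := hω'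
    simp only [hB1, hB2, hB3, hB4, hB5, hA, Set.mem_iUnion, not_exists, Set.mem_ofPred_eq, not_lt,
      one_div_div, Finset.univ_unique, Finset.sum_singleton, Fintype.card_unit, Fintype.card_fin,
      Nat.cast_one, one_mul, Nat.cast_add, Submodule.starProjection_top,
      ContinuousLinearMap.id_apply] at h1 h2 h3 h4 h5 h6 h7 h8
    refine ⟨h1, ?_, h3, h4, h5, h6, h7, h8⟩
    rw [← hnu]
    refine le_trans (le_of_eq ?_) h2
    rw [norm2, EuclideanSpace.norm_sq_eq]
    refine Finset.sum_congr rfl fun t _ => ?_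
    congr 2
    rw [PiLp.inner_apply]
    simp [window, conv, hu, mul_comm]

end

end

section

/-! ### The oracle inequality on the favourable event -/

variable {n : ℕ}

lemma shift_pow_apply (τ : ℕ) (x : ℤ → ℂ) (t : ℤ) : (shift ^ τ) x t = x (t - τ) := by
  induction τ generalizing t with
  | zero => simp
  | succ k ih =>
    rw [pow_succ', Module.End.mul_apply]
    change (shift ^ k) x (t - 1) = _
    rw [ih]
    congr 1
    push_cast
    ring

lemma conv_eq_sum_shift (φ : Fin (n + 1) → ℂ) (x : ℤ → ℂ) :
    conv φ x = ∑ τ : Fin (n + 1), φ τ • (shift ^ (τ : ℕ)) x := by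
  funext t
  simp [conv, shift_pow_apply]

lemma conv_mem_of_map_shift_eq {S : Submodule ℂ (ℤ → ℂ)} (hS : S.map shift = S)
    (φ : Fin (n + 1) → ℂ) {x : ℤ → ℂ} (hx : x ∈ S) : conv φ x ∈ S := by
  have hpow : ∀ τ : ℕ, (shift ^ τ) x ∈ S := by
    intro τ
    induction τ with
    | zero => simpa
    | succ k ih =>
      rw [pow_succ', Module.End.mul_apply, ← hS]
      exact Submodule.mem_map_of_mem ih
  rw [conv_eq_sum_shift]
  exact S.sum_mem fun τ _ => S.smul_mem _ (hpow τ)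

lemma conv_add (φ : Fin (n + 1) → ℂ) (x y : ℤ → ℂ) : conv φ (x + y) = conv φ x + conv φ y := by
  funext t; simp [conv, mul_add, Finset.sum_add_distrib]

lemma conv_smul (φ : Fin (n + 1) → ℂ) (c : ℂ) (x : ℤ → ℂ) : conv φ (c • x) = c • conv φ x := by
  funext t; simp [conv, Finset.mul_sum, mul_left_comm]

lemma window_add (x y : ℤ → ℂ) : window n (x + y) = window n x + window n y := rfl

lemma window_sub (x y : ℤ → ℂ) : window n (x - y) = window n x - window n y := rfl

lemma window_smul (c : ℂ) (x : ℤ → ℂ) : window n (c • x) = c • window n x := rfl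

lemma window_conv_eq_sum (φ : Fin (n + 1) → ℂ) (x : ℤ → ℂ) :
    window n (conv φ x) = ∑ τ : Fin (n + 1), φ τ • window n ((shift ^ (τ : ℕ)) x) := by
  rw [conv_eq_sum_shift]
  exact (map_sum (windowLin n) _ _).trans (Finset.sum_congr rfl fun τ _ => map_smul _ _ _)

/-- The bracket is at most `3 log (63 n / α)`, because `2 ≤ log 8` and `48 (2n)³ ≤ (63n)³`. The
factor `30` is half of the `60` in `lamLow`, the other factor being the `2σ` of the basic
inequality. -/
lemma log_threshold_bound (hn : 1 ≤ n) {α : ℝ} (h0 : 0 < α) (h1 : α ≤ 1) :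
    8 * (2 + 2 * Real.log (n + 1) + Real.log (6 * (n + 1) / α)) ≤
      30 * Real.log (63 * n / α) := by
  have hn1 : (1 : ℝ) ≤ n := by exact_mod_cast hn
  have hn0 : (0 : ℝ) < n := by linarith
  have hα : 1 ≤ 1 / α := by rw [le_div_iff₀ h0]; linarith
  set a := 1 / α with ha
  have e1 : 6 * ((n : ℝ) + 1) / α = 6 * (n + 1) * a := by rw [ha]; ring
  have e2 : 63 * (n : ℝ) / α = 63 * n * a := by rw [ha]; ring
  rw [e1, e2]
  have hlog8 : (2 : ℝ) ≤ Real.log 8 := by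
    have : (8 : ℝ) = 2 ^ (3 : ℕ) := by norm_num
    rw [this, Real.log_pow]
    have := Real.log_two_gt_d9
    norm_num
    linarith
  have hL : 0 ≤ Real.log (63 * n * a) := Real.log_nonneg (by nlinarith)
  have hsum : Real.log 8 + 2 * Real.log (n + 1) + Real.log (6 * (n + 1) * a)
      ≤ 3 * Real.log (63 * n * a) := by
    have e3 : 2 * Real.log ((n : ℝ) + 1) = Real.log ((n + 1) ^ 2) := by
      rw [Real.log_pow]; norm_num
    have e4 : 3 * Real.log (63 * n * a) = Real.log ((63 * n * a) ^ 3) := by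
      rw [Real.log_pow]; norm_num
    rw [e3, e4, ← Real.log_mul (by positivity) (by positivity),
      ← Real.log_mul (by positivity) (by positivity)]
    apply Real.log_le_log (by positivity)
    have h3 : ((n : ℝ) + 1) ^ 3 ≤ (2 * n) ^ 3 := pow_le_pow_left₀ (by positivity) (by linarith) 3
    have h4 : a ≤ a ^ 3 := le_self_pow₀ hα (by norm_num)
    calc 8 * ((n : ℝ) + 1) ^ 2 * (6 * (n + 1) * a) = 48 * ((n + 1) ^ 3 * a) := by ring
      _ ≤ 48 * ((2 * n) ^ 3 * a ^ 3) := by gcongr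
      _ ≤ (63 * n * a) ^ 3 := by
        have : 0 ≤ (n : ℝ) ^ 3 * a ^ 3 := by positivity
        nlinarith
  linarith

namespace GoodNoise

variable {K : Submodule ℂ (EuclideanSpace ℂ (Fin (n + 1)))} {v : EuclideanSpace ℂ (Fin (n + 1))}
  {φo : Fin (n + 1) → ℂ} {e : Fin (n + 1) → EuclideanSpace ℂ (Fin (n + 1))} {D α : ℝ} {z : ℤ → ℂ}

/-- The event was fixed before the filter, so this applies to the data-dependent minimizer. The
weights `1/2`, `1/4`, `1/4` of the three forms sum to one. -/
lemma norm_inner_conv_perp_le (h : GoodNoise n K v φo e D α z) (hn : 1 ≤ n) (h0 : 0 < α)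
    (h1 : α ≤ 1) (φ : Fin (n + 1) → ℂ) :
    ‖inner ℂ (Kᗮ.starProjection (window n z)) (window n (conv φ z))‖ ≤
      normSpec φ * (30 * Real.log (63 * n / α)) := by
  refine norm_inner_window_conv_le z _ (fun k => ?_) φ
  have := norm_inner_window_conv_charVec_le (freq_pow n k) (norm_freq n k) z
    (Kᗮ.starProjection (window n z))
  have hb := mul_le_mul_of_nonneg_left (log_threshold_bound hn h0 h1)
    (show (0 : ℝ) ≤ n + 1 by positivity)
  have := h.form_perp_le k
  have := h.form_pos_le k
  have := h.form_neg_le k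
  linarith

lemma norm_inner_conv_le (h : GoodNoise n K v φo e D α z) (hn : 1 ≤ n) (h0 : 0 < α)
    (h1 : α ≤ 1) (φ : Fin (n + 1) → ℂ) :
    ‖inner ℂ (window n z) (window n (conv φ z))‖ ≤
      normSpec φ * (30 * Real.log (63 * n / α)) := by
  refine norm_inner_window_conv_le z _ (fun k => ?_) φ
  have := norm_inner_window_conv_charVec_le (freq_pow n k) (norm_freq n k) z (window n z)
  have hb := mul_le_mul_of_nonneg_left (log_threshold_bound hn h0 h1)
    (show (0 : ℝ) ≤ n + 1 by positivity)
  have := h.form_pos_le k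
  have := h.form_neg_le k
  linarith

end GoodNoise

lemma obs_eq {Ω : Type*} (x : ℤ → ℂ) (σ : ℝ) (ζ : ℤ → Ω → ℂ) (ω : Ω) :
    obs x σ ζ ω = x + (σ : ℂ) • (fun τ => ζ τ ω) := rfl

/-- The correlation between the noise and the residual of an arbitrary filter. -/
lemma norm_inner_residual_le {S : Submodule ℂ (ℤ → ℂ)} (hS : S.map shift = S) {xS ε z : ℤ → ℂ}
    (hxS : xS ∈ S) {v : EuclideanSpace ℂ (Fin (n + 1))} {φo : Fin (n + 1) → ℂ} {D α σ : ℝ}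
    (hD : 0 ≤ D) (hσ : 0 ≤ σ)
    (h : GoodNoise n (S.map (windowLin n)) v φo
      (fun τ => (S.map (windowLin n))ᗮ.starProjection (window n ((shift ^ (τ : ℕ)) ε))) D α z)
    (hn : 1 ≤ n) (h0 : 0 < α) (h1 : α ≤ 1) (φ : Fin (n + 1) → ℂ) :
    ‖inner ℂ (window n z) (window n (xS + ε - conv φ (xS + ε + (σ : ℂ) • z)))‖ ≤
      ‖(S.map (windowLin n)).starProjection (window n z)‖ *
          norm2 n (xS + ε - conv φ (xS + ε + (σ : ℂ) • z))
        + (1 + normSpec φ) * D * Real.sqrt (4 * (1 + Real.log (10 / α)))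
        + σ * (normSpec φ * (30 * Real.log (63 * n / α))) := by
  set K := S.map (windowLin n) with hK
  set X := window n (xS + ε - conv φ (xS + ε + (σ : ℂ) • z)) with hX
  set g := Real.sqrt (4 * (1 + Real.log (10 / α))) with hg
  have hh : 0 ≤ 4 * (1 + Real.log (10 / α)) := by
    have : 0 ≤ Real.log (10 / α) := Real.log_nonneg (by rw [le_div_iff₀ h0]; linarith)
    linarith
  have hdecomp : window n z = K.starProjection (window n z) + Kᗮ.starProjection (window n z) :=
    (K.starProjection_add_starProjection_orthogonal _).symm
  set q := Kᗮ.starProjection (window n z) with hq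
  have hqS : ∀ y ∈ S, inner ℂ q (window n y) = 0 := by
    intro y hy
    exact Submodule.inner_left_of_mem_orthogonal (K := K) (Submodule.mem_map_of_mem hy)
      (Submodule.starProjection_apply_mem _ _)
  have hXeq : X = window n (xS - conv φ xS) + window n ε - window n (conv φ ε)
      - (σ : ℂ) • window n (conv φ z) := by
    rw [hX, conv_add, conv_add, conv_smul]
    simp only [window_sub, window_add, window_smul]
    abel
  -- Self-adjointness moves the projection onto the deterministic vectors built from `ε`, whose
  -- pairings with the noise are controlled by `GoodNoise`.
  have hqε : ∀ τ : ℕ, ‖inner ℂ q (window n ((shift ^ τ) ε))‖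
      = ‖inner ℂ (Kᗮ.starProjection (window n ((shift ^ τ) ε))) (window n z)‖ := by
    intro τ
    rw [hq, norm_inner_symm, Submodule.inner_starProjection_left_eq_right]
  have t1 : ‖inner ℂ q (window n ε)‖ ≤ D * g := by
    have e1 := h.err_le
    have e2 := hqε 0
    simp only [pow_zero, Fin.val_zero, Module.End.one_apply] at e1 e2
    rw [e2, hg]
    refine (sq_le_sq₀ (norm_nonneg _) (by positivity)).1 ?_
    rw [mul_pow, Real.sq_sqrt hh]
    exact e1
  -- Cauchy–Schwarz over the shifts separates the random coefficients of `φ` from the fixed vectors;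
  -- the factor `√(n+1)` turns `specNorm1` into `normSpec`.
  have t2 : ‖inner ℂ q (window n (conv φ ε))‖ ≤ normSpec φ * (D * g) := by
    rw [window_conv_eq_sum, inner_sum]
    have e1 := h.errs_le
    calc ‖∑ τ : Fin (n + 1), inner ℂ q (φ τ • window n ((shift ^ (τ : ℕ)) ε))‖
        ≤ ∑ τ : Fin (n + 1), ‖φ τ‖ *
          ‖inner ℂ (Kᗮ.starProjection (window n ((shift ^ (τ : ℕ)) ε))) (window n z)‖ := by
          refine (norm_sum_le _ _).trans (Finset.sum_le_sum fun τ _ => ?_)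
          rw [inner_smul_right, norm_mul, hqε]
      _ ≤ Real.sqrt (∑ τ : Fin (n + 1), ‖φ τ‖ ^ 2) * Real.sqrt (∑ τ : Fin (n + 1),
          ‖inner ℂ (Kᗮ.starProjection (window n ((shift ^ (τ : ℕ)) ε))) (window n z)‖ ^ 2) :=
          Real.sum_mul_le_sqrt_mul_sqrt _ _ _
      _ ≤ specNorm1 φ * (Real.sqrt ((n : ℝ) + 1) * (D * g)) := by
          refine mul_le_mul ?_ ?_ (Real.sqrt_nonneg _) (specNorm1_nonneg φ)
          · rw [← EuclideanSpace.norm_eq (WithLp.toLp 2 φ : EuclideanSpace ℂ (Fin (n + 1)))]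
            exact norm_toLp_le_specNorm1 φ
          · rw [Real.sqrt_le_left (by positivity), mul_pow, mul_pow, hg, Real.sq_sqrt hh,
              Real.sq_sqrt (by positivity), ← mul_assoc]
            exact e1
      _ = _ := by rw [normSpec]; ring
  have t3 := h.norm_inner_conv_perp_le hn h0 h1 φ
  have hqX : ‖inner ℂ q X‖ ≤ (1 + normSpec φ) * D * g
        + σ * (normSpec φ * (30 * Real.log (63 * n / α))) := by
    rw [hXeq, inner_sub_right, inner_sub_right, inner_add_right,
      hqS _ (S.sub_mem hxS (conv_mem_of_map_shift_eq hS φ hxS)), zero_add, inner_smul_right]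
    refine (norm_sub_le _ _).trans ?_
    rw [norm_mul, Complex.norm_real, Real.norm_of_nonneg hσ]
    have := norm_sub_le (inner ℂ q (window n ε)) (inner ℂ q (window n (conv φ ε)))
    have := mul_le_mul_of_nonneg_left t3 hσ
    linarith
  rw [hdecomp, inner_add_left]
  refine (norm_add_le _ _).trans ?_
  rw [← hdecomp]
  have := norm_inner_le_norm (𝕜 := ℂ) (K.starProjection (window n z)) X
  have e : norm2 n (xS + ε - conv φ (xS + ε + (σ : ℂ) • z)) = ‖X‖ := rfl
  rw [e]
  linarith

/-- The correlation between the noise and the residual of the oracle filter. -/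
lemma norm_inner_oracle_residual_le {K : Submodule ℂ (EuclideanSpace ℂ (Fin (n + 1)))}
    {x z : ℤ → ℂ} {φo : Fin (n + 1) → ℂ} {e : Fin (n + 1) → EuclideanSpace ℂ (Fin (n + 1))}
    {D α σ : ℝ} (hσ : 0 ≤ σ)
    (h : GoodNoise n K (window n (x - conv φo x)) φo e D α z)
    (hn : 1 ≤ n) (h0 : 0 < α) (h1 : α ≤ 1) :
    ‖inner ℂ (window n z) (window n (x - conv φo (x + (σ : ℂ) • z)))‖ ≤
      (norm2 n (x - conv φo (x + (σ : ℂ) • z))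
        + σ * (normSpec φo * Real.sqrt (4 * (1 + Real.log (10 / α))))) *
          Real.sqrt (4 * (1 + Real.log (10 / α)))
        + σ * (normSpec φo * (30 * Real.log (63 * n / α))) := by
  set g := Real.sqrt (4 * (1 + Real.log (10 / α))) with hg
  have hh : 0 ≤ 4 * (1 + Real.log (10 / α)) := by
    have : 0 ≤ Real.log (10 / α) := Real.log_nonneg (by rw [le_div_iff₀ h0]; linarith)
    linarith
  have hg0 : 0 ≤ g := Real.sqrt_nonneg _
  set V := window n (x - conv φo x) with hV
  set X := window n (x - conv φo (x + (σ : ℂ) • z)) with hX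
  have hXeq : X = V - (σ : ℂ) • window n (conv φo z) := by
    rw [hX, conv_add, conv_smul, hV]
    simp only [window_sub, window_add, window_smul]
    abel
  have t1 : ‖inner ℂ (window n z) V‖ ≤ ‖V‖ * g := by
    rw [norm_inner_symm]
    refine (sq_le_sq₀ (norm_nonneg _) (by positivity)).1 ?_
    rw [mul_pow, hg, Real.sq_sqrt hh]
    exact h.bias_le
  have t2 : ‖window n (conv φo z)‖ ≤ normSpec φo * g := by
    refine (sq_le_sq₀ (norm_nonneg _) (mul_nonneg (normSpec_nonneg _) hg0)).1 ?_
    refine h.conv_le.trans ?_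
    rw [mul_pow, hg, Real.sq_sqrt hh, normSpec, mul_pow, Real.sq_sqrt (by positivity)]
    have := pow_le_pow_left₀ (norm_nonneg _) (norm_toLp_le_specNorm1 φo) 2
    gcongr
  have t3 := h.norm_inner_conv_le hn h0 h1 φo
  -- The deviation bound concerns the deterministic `V`, while the oracle inequality is stated with
  -- the noisy residual `X`.
  have t4 : ‖V‖ ≤ ‖X‖ + σ * (normSpec φo * g) := by
    have : V = X + (σ : ℂ) • window n (conv φo z) := by rw [hXeq]; abel
    rw [this]
    refine (norm_add_le _ _).trans ?_
    rw [norm_smul, Complex.norm_real, Real.norm_of_nonneg hσ]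
    gcongr
  have e : norm2 n (x - conv φo (x + (σ : ℂ) • z)) = ‖X‖ := rfl
  rw [e]
  calc ‖inner ℂ (window n z) X‖
      ≤ ‖inner ℂ (window n z) V‖ + σ * ‖inner ℂ (window n z) (window n (conv φo z))‖ := by
        rw [hXeq, inner_sub_right, inner_smul_right]
        refine (norm_sub_le _ _).trans ?_
        rw [norm_mul, Complex.norm_real, Real.norm_of_nonneg hσ]
    _ ≤ ‖V‖ * g + σ * (normSpec φo * (30 * Real.log (63 * n / α))) := by gcongr
    _ ≤ _ := by gcongr

/-- Comparison of the objective at a minimizer and at another filter. -/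
lemma IsPenalizedFilter.basic_inequality {x z : ℤ → ℂ} {σ lam : ℝ} {φ : Fin (n + 1) → ℂ}
    (hφ : IsPenalizedFilter n lam (x + (σ : ℂ) • z) φ) (hσ : 0 ≤ σ) (φo : Fin (n + 1) → ℂ) :
    norm2 n (x - conv φ (x + (σ : ℂ) • z)) ^ 2 + lam * normSpec φ ≤
      norm2 n (x - conv φo (x + (σ : ℂ) • z)) ^ 2 + lam * normSpec φo
      + 2 * σ * ‖inner ℂ (window n z) (window n (x - conv φ (x + (σ : ℂ) • z)))‖
      + 2 * σ * ‖inner ℂ (window n z) (window n (x - conv φo (x + (σ : ℂ) • z)))‖ := by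
  -- The noise energy `‖σ z‖²` does not depend on the filter and cancels in the comparison.
  have key : ∀ ψ : Fin (n + 1) → ℂ, penObjective n lam (x + (σ : ℂ) • z) ψ =
      norm2 n (x - conv ψ (x + (σ : ℂ) • z)) ^ 2 + 2 * σ *
        (inner ℂ (window n z) (window n (x - conv ψ (x + (σ : ℂ) • z)))).re
        + ‖(σ : ℂ) • window n z‖ ^ 2 + lam * normSpec ψ := by
    intro ψ
    have e : window n (x + (σ : ℂ) • z - conv ψ (x + (σ : ℂ) • z))
        = (σ : ℂ) • window n z + window n (x - conv ψ (x + (σ : ℂ) • z)) := by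
      simp only [window_sub, window_add, window_smul]
      abel
    rw [penObjective, norm2, e, @norm_add_sq ℂ, inner_smul_left, normSpec, norm2]
    simp
    ring
  have h1 := hφ φo
  rw [key, key] at h1
  have h2 := mul_le_mul_of_nonneg_left (Complex.abs_re_le_norm
    (inner ℂ (window n z) (window n (x - conv φ (x + (σ : ℂ) • z))))) hσ
  have h3 := mul_le_mul_of_nonneg_left (Complex.abs_re_le_norm
    (inner ℂ (window n z) (window n (x - conv φo (x + (σ : ℂ) • z))))) hσ
  have h4 := mul_le_mul_of_nonneg_left (neg_abs_le
    (inner ℂ (window n z) (window n (x - conv φ (x + (σ : ℂ) • z)))).re) hσ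
  have h5 := mul_le_mul_of_nonneg_left (le_abs_self
    (inner ℂ (window n z) (window n (x - conv φo (x + (σ : ℂ) • z)))).re) hσ
  linarith

end

section

/-! ### Elementary inequalities and conclusion -/

/-- Completing squares gives `(r - b)² ≤ (r0 + a + b + √c)²`. The coefficient of `r0` stays exactly
one. -/
lemma le_of_sq_le_add {r r0 a b c : ℝ} (hr0 : 0 ≤ r0) (ha : 0 ≤ a) (hb : 0 ≤ b) (hc : 0 ≤ c)
    (h : r ^ 2 ≤ r0 ^ 2 + 2 * a * r0 + 2 * b * r + c) : r ≤ r0 + a + 2 * b + Real.sqrt c := by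
  have hs := Real.sqrt_nonneg c
  have hsq := Real.sq_sqrt hc
  have : r - b ≤ r0 + a + b + Real.sqrt c := by
    refine (le_abs_self _).trans (abs_le_of_sq_le_sq ?_ (by positivity))
    nlinarith [mul_nonneg hr0 hb, mul_nonneg hr0 hs, mul_nonneg ha hb, mul_nonneg ha hs,
      mul_nonneg hb hs, sq_nonneg a]
  linarith

/-- The error bound implied by the quadratic inequality for the residual. -/
lemma residual_le_of_quadratic {r r0 σ g q rho lam T s A : ℝ} (hr0 : 0 ≤ r0) (hσ : 0 ≤ σ)
    (hg : 0 ≤ g) (hq : 0 ≤ q) (hrho : 1 ≤ rho) (hT : 0 ≤ T) (hs : 0 ≤ s)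
    (hgl : σ ^ 2 * g ^ 2 ≤ lam / 15) (hAl : σ ^ 2 * A ≤ lam / 15) (hqs : q ^ 2 ≤ 4 * (s + A))
    (h : r ^ 2 ≤ r0 ^ 2 + 2 * (σ * g) * r0 + 2 * (σ * q) * r + (3 * (lam * rho) + T)) :
    r ≤ r0 + 7 * Real.sqrt (rho * lam) + 4 * σ * Real.sqrt s + Real.sqrt T := by
  have hlam : 0 ≤ lam := by nlinarith [mul_nonneg (sq_nonneg σ) (sq_nonneg g)]
  have hrl : lam ≤ rho * lam := le_mul_of_one_le_left hlam hrho
  have hmain := le_of_sq_le_add hr0 (mul_nonneg hσ hg) (mul_nonneg hσ hq)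
    (by positivity : 0 ≤ 3 * (lam * rho) + T) h
  set R := Real.sqrt (rho * lam) with hR
  have hR0 : 0 ≤ R := Real.sqrt_nonneg _
  have hRsq : R ^ 2 = rho * lam := Real.sq_sqrt (by positivity)
  have h1 : σ * g ≤ R := by
    refine (sq_le_sq₀ (by positivity) hR0).1 ?_
    rw [hRsq, mul_pow]; linarith
  have h2 : σ * q ≤ 2 * (σ * Real.sqrt s) + R := by
    refine (sq_le_sq₀ (by positivity) (by positivity)).1 ?_
    have e := Real.sq_sqrt hs
    have h3 : 0 ≤ σ * Real.sqrt s * R := by positivity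
    have h4 : σ ^ 2 * q ^ 2 ≤ σ ^ 2 * (4 * (s + A)) := by gcongr
    have h5 : (σ * Real.sqrt s) ^ 2 = σ ^ 2 * s := by rw [mul_pow, e]
    nlinarith
  have h3 : Real.sqrt (3 * (lam * rho) + T) ≤ 2 * R + Real.sqrt T := by
    rw [Real.sqrt_le_left (by positivity)]
    have := Real.sq_sqrt hT
    have := mul_nonneg hR0 (Real.sqrt_nonneg T)
    nlinarith
  linarith

lemma sqrt_deviation_le {α : ℝ} (h0 : 0 < α) (h1 : α ≤ 1) :
    Real.sqrt (4 * (1 + Real.log (10 / α))) ≤ 3 * Real.sqrt (Real.log (16 / α)) := by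
  have hα : 1 ≤ 1 / α := by rw [le_div_iff₀ h0]; linarith
  have hl : 0 ≤ Real.log (1 / α) := Real.log_nonneg hα
  have h16 : Real.log (16 / α) = Real.log 16 + Real.log (1 / α) := by
    rw [← Real.log_mul (by norm_num) (by positivity)]; congr 1; ring
  have h10 : Real.log (10 / α) ≤ Real.log (16 / α) :=
    Real.log_le_log (by positivity) (by gcongr; norm_num)
  have h16' : (2 : ℝ) ≤ Real.log 16 := by
    rw [show (16 : ℝ) = 2 ^ (4 : ℕ) by norm_num, Real.log_pow]
    have := Real.log_two_gt_d9
    norm_num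
    linarith
  have h3 : (3 : ℝ) = Real.sqrt 9 := by
    rw [show (9 : ℝ) = 3 ^ 2 by norm_num, Real.sqrt_sq (by norm_num)]
  rw [h3, ← Real.sqrt_mul (by norm_num)]
  apply Real.sqrt_le_sqrt
  linarith

/-- The additive `1` is absorbed by `log 6`, and `6 · 10 ≤ 63 n`. -/
lemma deviation_le_log {n : ℕ} (hn : 1 ≤ n) {α : ℝ} (h0 : 0 < α) :
    1 + Real.log (10 / α) ≤ Real.log (63 * n / α) := by
  have hn1 : (1 : ℝ) ≤ n := by exact_mod_cast hn
  have h1 : (1 : ℝ) ≤ Real.log 6 := by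
    rw [Real.le_log_iff_exp_le (by norm_num)]
    have := Real.exp_one_lt_d9
    linarith
  have h2 : Real.log 6 + Real.log (10 / α) ≤ Real.log (63 * n / α) := by
    rw [← Real.log_mul (by norm_num) (by positivity), ← mul_div_assoc]
    exact Real.log_le_log (by positivity) (div_le_div_of_nonneg_right (by linarith) h0.le)
  linarith

lemma kapBar_mul_sqrt {n : ℕ} (hn : 1 ≤ n) {α : ℝ} (h0 : 0 < α) (h1 : α ≤ 1) :
    kapBar n α * Real.sqrt (Real.log (16 / α)) ≤ 10 * Real.log (63 * n / α) := by
  have hn1 : (1 : ℝ) ≤ n := by exact_mod_cast hn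
  have : 0 < Real.log (16 / α) := Real.log_pos (by rw [lt_div_iff₀ h0]; linarith)
  rw [kapBar, div_mul_cancel₀ _ (Real.sqrt_pos.2 this).ne']
  have := Real.log_le_log (show 0 < 42 * (n : ℝ) / α by positivity)
    (show 42 * (n : ℝ) / α ≤ 63 * n / α by gcongr; norm_num)
  linarith

lemma sqrt_log_sixteen_le {α : ℝ} (h0 : 0 < α) (h1 : α ≤ 1 / 2) :
    Real.sqrt (Real.log (16 / α)) ≤ 3 * Real.sqrt (Real.log (1 / α)) := by
  have h3 : (3 : ℝ) = Real.sqrt 9 := by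
    rw [show (9 : ℝ) = 3 ^ 2 by norm_num, Real.sqrt_sq (by norm_num)]
  rw [h3, ← Real.sqrt_mul (by norm_num)]
  apply Real.sqrt_le_sqrt
  have h16 : Real.log (16 / α) = 4 * Real.log 2 + Real.log (1 / α) := by
    rw [show 4 * Real.log 2 = Real.log (2 ^ 4) by rw [Real.log_pow]; norm_num,
      ← Real.log_mul (by norm_num) (by positivity)]
    congr 1; ring
  have h2 : Real.log 2 ≤ Real.log (1 / α) := by
    apply Real.log_le_log (by norm_num)
    rw [le_div_iff₀ h0]; linarith
  have := Real.log_nonneg (show (1 : ℝ) ≤ 2 by norm_num)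
  linarith

/-- Recombination of the two contributions of the subspace. -/
lemma sqrt_add_sqrt_le {σ s T W c : ℝ} (hσ : 0 ≤ σ) (hs : 0 ≤ s) (hW : 0 < σ → 0 ≤ W)
    (hc : 1 ≤ c) (hT : T ≤ 6 * c * (σ ^ 2 * W)) :
    4 * σ * Real.sqrt s + Real.sqrt T ≤ 7 * c * σ * Real.sqrt (s + W) := by
  -- For `σ = 0` the sign of `W` is unknown, but then `T ≤ 0` and its square root is `0` by
  -- convention.
  rcases hσ.eq_or_lt with rfl | hpos
  · have : T ≤ 0 := by simpa using hT
    simp [Real.sqrt_eq_zero_of_nonpos this]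
  · have hW' := hW hpos
    have h1 : Real.sqrt s ≤ Real.sqrt (s + W) := Real.sqrt_le_sqrt (by linarith)
    have h2 : Real.sqrt T ≤ 3 * c * σ * Real.sqrt (s + W) := by
      rw [Real.sqrt_le_left (by positivity), mul_pow, Real.sq_sqrt (by positivity)]
      refine hT.trans ?_
      have hcc : c ≤ c ^ 2 := le_self_pow₀ hc (by norm_num)
      have : σ ^ 2 * W ≤ σ ^ 2 * (s + W) := by gcongr; linarith
      have h0 : 0 ≤ σ ^ 2 * W := by positivity
      calc 6 * c * (σ ^ 2 * W) ≤ 9 * c ^ 2 * (σ ^ 2 * (s + W)) := by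
            gcongr; norm_num
        _ = _ := by ring
    have h3 : 4 * σ * Real.sqrt s ≤ 4 * σ * Real.sqrt (s + W) := by gcongr
    have h4 : 4 * σ * Real.sqrt (s + W) ≤ 4 * c * σ * Real.sqrt (s + W) := by
      gcongr
      linarith
    linarith

end

end FilterRecovery

end

/-! ### Assembly of the two oracle inequalities. -/

open FilterRecovery in
theorem mainTheorem2 :
    ∃ C > (0 : ℝ), ∃ C' > (0 : ℝ),
      ∀ (Ω : Type*) [MeasurableSpace Ω] (μ : Measure Ω) [IsProbabilityMeasure μ]
        (n : ℕ) (_ : 1 ≤ n) (σ : ℝ) (_ : 0 ≤ σ)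
        (ζ : ℤ → Ω → ℂ) (_ : IsStdNoise μ n ζ)
        (x : ℤ → ℂ) (s : ℕ) (kap : ℝ) (_ : NearShiftInvariant n s σ kap x)
        (rho : ℝ) (_ : 1 ≤ rho)
        (φo : Fin (n + 1) → ℂ) (_ : specNorm1 φo ≤ rho / Real.sqrt ((n : ℝ) + 1))
        (α : ℝ) (_ : 0 < α) (_ : α ≤ 1)
        (lam : ℝ) (_ : lamLow n σ α ≤ lam),
        -- the estimator exists, whatever the realization of the noise
        (∀ ω, ∃ φ : Fin (n + 1) → ℂ, IsPenalizedFilter n lam (obs x σ ζ ω) φ) ∧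
        -- an event of probability at least `1 - α`
        ∃ Ξ : Set Ω, MeasurableSet Ξ ∧ 1 - α ≤ μ.real Ξ ∧
          ∀ ω ∈ Ξ, ∀ φ : Fin (n + 1) → ℂ, IsPenalizedFilter n lam (obs x σ ζ ω) φ →
            -- first part
            norm2 n (x - conv φ (obs x σ ζ ω)) ≤
                norm2 n (x - conv φo (obs x σ ζ ω)) + C * Real.sqrt (rho * lam)
                  + C' * σ * Real.sqrt
                      (s + (normSpec φ + 1) * kap * Real.sqrt (Real.log (16 / α))) ∧
            (α ≤ 1 / 2 →
              norm2 n (x - conv φ (obs x σ ζ ω)) ≤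
                norm2 n (x - conv φo (obs x σ ζ ω)) + C * Real.sqrt (rho * lam)
                  + C' * σ * Real.sqrt
                      (s + (normSpec φ + 1) * kap * Real.sqrt (Real.log (1 / α)))) ∧
            -- second part
            (kap ≤ kapBar n α → 2 * lamLow n σ α ≤ lam →
              norm2 n (x - conv φ (obs x σ ζ ω)) ≤
                norm2 n (x - conv φo (obs x σ ζ ω)) + C * Real.sqrt (rho * lam)
                  + C' * σ * Real.sqrt s) := by
  -- Here `21 = 7 · 3`, the `3` being the price of replacing `log (16 / α)` by `log (1 / α)`.
  refine ⟨7, by norm_num, 21, by norm_num, ?_⟩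
  intro Ω _ μ _ n hn σ hσ ζ hζ x s kap hx rho hrho φo hφo α h0 h1 lam hlam
  obtain ⟨hs1, -, S, hS, hdim, xS, hxS, ε, rfl, hε⟩ := hx
  set L := Real.log (63 * n / α) with hL
  have hdev := deviation_le_log hn h0
  have hA0 : 0 ≤ Real.log (10 / α) := Real.log_nonneg (by rw [le_div_iff₀ h0]; linarith)
  rw [← hL] at hdev
  have hlow : lamLow n σ α = 60 * σ ^ 2 * L := rfl
  rw [hlow] at hlam
  have hσL : 0 ≤ σ ^ 2 * L := mul_nonneg (sq_nonneg _) (by linarith)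
  have hlam0 : 0 ≤ lam := by linarith
  refine ⟨fun ω => exists_isPenalizedFilter hlam0 _, ?_⟩
  have hD : 0 ≤ σ * kap := (norm_nonneg _).trans (hε 0 (Nat.zero_le n))
  -- The sign of `kap` is not assumed; it follows from a norm being at most `σ * kap`, hence only
  -- for positive `σ`.
  have hkap : 0 < σ → 0 ≤ kap := fun h => nonneg_of_mul_nonneg_right hD h
  obtain ⟨Ξ, hΞm, hΞ, hgood⟩ := exists_measurableSet_goodNoise hζ (S.map (windowLin n))
    (window n (xS + ε - conv φo (xS + ε))) φo
    (fun τ => (S.map (windowLin n))ᗮ.starProjection (window n ((shift ^ (τ : ℕ)) ε)))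
    (D := σ * kap) (fun τ => (Submodule.norm_starProjection_apply_le _ _).trans
      (hε τ (Nat.lt_succ_iff.1 τ.2))) h0
  refine ⟨Ξ, hΞm, hΞ, fun ω hω φ hφ => ?_⟩
  have hg := hgood ω hω
  rw [obs_eq] at hφ ⊢
  set z : ℤ → ℂ := fun τ => ζ τ ω with hz
  have hbasic := hφ.basic_inequality hσ φo
  have hfit := norm_inner_residual_le hS hxS hD hσ hg hn h0 h1 φ
  have hora := norm_inner_oracle_residual_le hσ hg hn h0 h1
  rw [← hL] at hfit hora
  set r := norm2 n (xS + ε - conv φ (xS + ε + (σ : ℂ) • z)) with hr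
  set r0 := norm2 n (xS + ε - conv φo (xS + ε + (σ : ℂ) • z)) with hr0
  set q := ‖(S.map (windowLin n)).starProjection (window n z)‖ with hqdef
  set g := Real.sqrt (4 * (1 + Real.log (10 / α))) with hgdef
  have hg0 : 0 ≤ g := Real.sqrt_nonneg _
  have hgsq : g ^ 2 = 4 * (1 + Real.log (10 / α)) := Real.sq_sqrt (by linarith)
  have hr00 : 0 ≤ r0 := norm_nonneg _
  have hq0 : 0 ≤ q := norm_nonneg _
  have hP := normSpec_nonneg φ
  set P := normSpec φ with hPdef
  have hPo := normSpec_nonneg φo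
  have hPrho : normSpec φo ≤ rho := by
    rw [normSpec, mul_comm]
    exact (le_div_iff₀ (Real.sqrt_pos.2 (by positivity))).1 hφo
  set Po := normSpec φo with hPodef
  have hgl : σ ^ 2 * g ^ 2 ≤ lam / 15 := by
    rw [hgsq]
    have := mul_le_mul_of_nonneg_left hdev (sq_nonneg σ)
    linarith
  have hAl : σ ^ 2 * Real.log (10 / α) ≤ lam / 15 := by
    have := mul_le_mul_of_nonneg_left hdev (sq_nonneg σ)
    have := sq_nonneg σ
    linarith
  have hqs : q ^ 2 ≤ 4 * (s + Real.log (10 / α)) := by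
    refine hg.proj_le.trans ?_
    -- `finrank` is `0` in infinite dimension, so `1 ≤ s` is what gives finite dimensionality.
    have hfin : FiniteDimensional ℂ S := by
      refine Module.finite_of_finrank_pos ?_
      omega
    have : Module.finrank ℂ (S.map (windowLin n)) ≤ s := by
      rw [← hdim]; exact Submodule.finrank_map_le _ _
    have : (Module.finrank ℂ (S.map (windowLin n)) : ℝ) ≤ s := by exact_mod_cast this
    linarith
  have hquad : r ^ 2 + lam * P ≤ r0 ^ 2 + 2 * (σ * g) * r0 + 2 * (σ * q) * r
      + (2 * (σ ^ 2 * g ^ 2) * rho + 60 * (σ ^ 2 * L) * rho + lam * rho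
        + 2 * σ * ((1 + P) * (σ * kap) * g) + 60 * (σ ^ 2 * L) * P) := by
    have e1 := mul_le_mul_of_nonneg_left hfit (show 0 ≤ 2 * σ by linarith)
    have e2 := mul_le_mul_of_nonneg_left hora (show 0 ≤ 2 * σ by linarith)
    have e3 : 2 * (σ ^ 2 * g ^ 2) * Po ≤ 2 * (σ ^ 2 * g ^ 2) * rho := by gcongr
    have e4 : 60 * (σ ^ 2 * L) * Po ≤ 60 * (σ ^ 2 * L) * rho := by gcongr
    have e5 : lam * Po ≤ lam * rho := by gcongr
    linarith
  have hT0 : 0 ≤ 2 * σ * ((1 + P) * (σ * kap) * g) := by positivity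
  have hrl : lam ≤ lam * rho := le_mul_of_one_le_right hlam0 hrho
  have hgl' : 2 * (σ ^ 2 * g ^ 2) * rho ≤ 2 * (lam / 15) * rho := by gcongr
  -- The whole penalty `lam * P` is spent on the chaos, so the `kap` term, with its factor `1 + P`,
  -- survives.
  have hfirst : r ≤ r0 + 7 * Real.sqrt (rho * lam) + 4 * σ * Real.sqrt s
      + Real.sqrt (2 * σ * ((1 + P) * (σ * kap) * g)) := by
    refine residual_le_of_quadratic hr00 hσ hg0 hq0 hrho hT0 (Nat.cast_nonneg s) hgl hAl hqs ?_
    have e1 : 60 * (σ ^ 2 * L) * rho ≤ lam * rho := by gcongr; linarith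
    have e2 : 60 * (σ ^ 2 * L) * P ≤ lam * P := by gcongr; linarith
    have : 0 ≤ lam * rho := by positivity
    linarith
  have hg16 := sqrt_deviation_le h0 h1
  rw [← hgdef] at hg16
  have hTle : ∀ l c : ℝ, g ≤ 3 * c * l → 2 * σ * ((1 + P) * (σ * kap) * g) ≤
      6 * c * (σ ^ 2 * ((P + 1) * kap * l)) := by
    intro l c hl
    have := mul_le_mul_of_nonneg_left hl (show 0 ≤ 2 * σ * ((1 + P) * (σ * kap)) by positivity)
    linarith
  refine ⟨?_, fun hα2 => ?_, fun hk hl2 => ?_⟩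
  · have := sqrt_add_sqrt_le hσ (Nat.cast_nonneg s) (fun h => by have := hkap h; positivity)
      le_rfl (hTle (Real.sqrt (Real.log (16 / α))) 1 (by linarith))
    have h7 : 7 * 1 * σ * Real.sqrt (s + (P + 1) * kap * Real.sqrt (Real.log (16 / α)))
        ≤ 21 * σ * Real.sqrt (s + (P + 1) * kap * Real.sqrt (Real.log (16 / α))) := by
      gcongr; norm_num
    linarith
  · have := sqrt_add_sqrt_le hσ (Nat.cast_nonneg s) (fun h => by have := hkap h; positivity)
      (by norm_num) (hTle (Real.sqrt (Real.log (1 / α))) 3 (by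
        have := sqrt_log_sixteen_le h0 hα2
        linarith))
    linarith
  · rw [hlow] at hl2
    have hkg : σ ^ 2 * (kap * g) ≤ σ ^ 2 * (30 * L) := by
      rcases hσ.eq_or_lt with h | h
      · rw [← h]; simp
      · have e1 := mul_le_mul_of_nonneg_left hg16 (hkap h)
        have e2 := mul_le_mul_of_nonneg_right hk (Real.sqrt_nonneg (Real.log (16 / α)))
        have e3 := kapBar_mul_sqrt hn h0 h1
        exact mul_le_mul_of_nonneg_left (by linarith) (sq_nonneg σ)
    -- With `lam` doubled, half of `lam * P` pays for the chaos. The other half absorbs the `kap`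
    -- term, since `kap * g ≤ 30 L` for positive `σ`, the same size as the chaos bound.
    have := residual_le_of_quadratic (r := r) (lam := lam) (T := 0) hr00 hσ hg0 hq0 hrho le_rfl
      (Nat.cast_nonneg s) hgl hAl hqs (by
        have e1 : 60 * (σ ^ 2 * L) * rho ≤ lam / 2 * rho := by gcongr; linarith
        have e2 : 60 * (σ ^ 2 * L) * P ≤ lam / 2 * P := by gcongr; linarith
        have e3 := mul_le_mul_of_nonneg_left hkg (show 0 ≤ 2 * (1 + P) by linarith)
        have : 0 ≤ lam * rho := by positivity
        linarith)
    rw [Real.sqrt_zero] at this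
    have h8 : 0 ≤ σ * Real.sqrt s := by positivity
    linarith
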